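/- Conventions. Let $\overline M$ be a complex manifold of complex dimension $2n+1$ with complex structure $J$. A normal indefinite complex contact structure on $\overline M$ consists of an open covering $\{\mathcal O_i\}$ with holomorphic $1$-forms $\theta_i$ on $\mathcal O_i$, $\theta_i\wedge(d\theta_i)^n\neq0$ everywhere, $\theta_i=f_{ij}\theta_j$ on $\mathcal O_i\cap\mathcal O_j$ with $f_{ij}$ holomorphic and nowhere zero; a $J$-Hermitian semi-Riemannian metric $\overline g$ of index $4q$, $0<q<n$; and on each $\mathcal O=\mathcal O_i$ smooth $1$-forms $u$, $v=u\circ J$, $\sigma$, vector fields $U$, $V=-JU$ and $(1,1)$-tensors $G$, $H=GJ$ such that $G^2=H^2=-I+u\otimes U+v\otimes V$, $\overline g(GX,Y)=-\overline g(X,GY)$, $\overline g(U,X)=u(X)$, $GJ=-JG$, $GU=0$, $u(U)=1$, $\theta_i$ is a nowhere zero complex multiple of $u-\sqrt{-1}\,v$, $$du(X,Y)=\overline g(X,GY)+(\sigma\wedge v)(X,Y),\qquad dv(X,Y)=\overline g(X,HY)-(\sigma\wedge u)(X,Y)$$ (with $2\,d\alpha(X,Y)=X\alpha(Y)-Y\alpha(X)-\alpha([X,Y])$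 and $2(\alpha\wedge\beta)(X,Y)=\alpha(X)\beta(Y)-\alpha(Y)\beta(X)$); on overlaps $u_j=au_i-bv_i$, $v_j=bu_i+av_i$, $G_j=aG_i-bH_i$, $H_j=bG_i+aH_i$ with $a^2+b^2=1$. Normality means that $S(X,Y)=T(X,Y)=0$ for all $X,Y$ with $u(X)=v(X)=u(Y)=v(Y)=0$ and $S(U,X)=T(V,X)=0$ for all $X$, where, with the Nijenhuis tensor $[A,A](X,Y)=A^2[X,Y]+[AX,AY]-A[AX,Y]-A[X,AY]$, $$\begin{aligned}S(X,Y)={}&[G,G](X,Y)+2\overline g(X,GY)U-2\overline g(X,HY)V+2\{v(Y)HX-v(X)HY\}\\&+\sigma(GY)HX-\sigma(GX)HY+\sigma(X)GHY-\sigma(Y)GHX,\\ T(X,Y)={}&[H,H](X,Y)-2\overline g(X,GY)U+2\overline g(X,HY)V+2\{u(Y)GX-u(X)GY\}\\&+\sigma(HX)GY-\sigma(HY)GX+\sigma(X)GHY-\sigma(Y)GHX.\end{aligned}$$ Put $J_1=J$, $J_2=G$, $J_3=H$. Let $M$ be an immersed real submanifold of $\overline M$ whose radical $\mathrm{Rad}\,TM=TM\cap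 TM^\perp$ is a smooth distribution of constant rank $r>0$ (a null submanifold). Choose smooth subbundles $S(TM)$ and $S(TM^\perp)$, complementary to $\mathrm{Rad}\,TM$ in $TM$ and in $TM^\perp$ respectively, and a smooth null subbundle $\mathrm{ltr}(TM)$ complementary to $\mathrm{Rad}\,TM$ in $S(TM)^\perp\cap S(TM^\perp)^\perp$, so that $T\overline M|_M=TM\oplus\mathrm{ltr}(TM)\oplus S(TM^\perp)$. With $\overline\nabla$ the Levi-Civita connection of $\overline g$, decompose accordingly $\overline\nabla_XY=\nabla_XY+h^l(X,Y)+h^s(X,Y)$ for $X,Y\in\Gamma(TM)$; $\nabla$ is the induced connection, and it is called a metric connection if $\nabla g=0$ for the induced (degenerate) metric $g$. $M$ is called screen real if $U,V\in S(TM^\perp)$, $J_a\mathrm{Rad}\,TM=\mathrm{Rad}\,TM$ and $J_aS(TM)\subset S(TM^\perp)$ for $a=1,2,3$ (along $M\cap\mathcal O_i$, for every $i$). In this case each $J_aS(TM)$ is nondegenerate, and the component of a vector in $J_aS(TM)$ is its orthogonal projection to $J_aS(TM)$. Theorem. Let $M$ be a screen real null submanifold of a normal indefinite complex contact manifold $\overline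 M$. Then the induced connection $\nabla$ is a metric connection if and only if, for all $a=1,2,3$, all $X\in\Gamma(TM)$ and all $\xi\in\Gamma(\mathrm{Rad}\,TM)$, the vector field $h^s(X,\xi)$ has no component in $J_aS(TM)$. Moreover, for each single $a\in\{1,2,3\}$, $\nabla$ is a metric connection if and only if $h^s(X,\xi)$ has no component in $J_aS(TM)$ for all such $X$ and $\xi$. (For $a=2,3$ the condition is imposed on $M\cap\mathcal O_i$ for every $i$.) -/

import Mathlib

open Set Filter Topology Bundle Manifold VectorField
open scoped ContDiff

namespace NullGeometry

/-! ### Linear algebra of a subspace of a scalar product space -/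

section LinearAlgebra

variable {V : Type*} [AddCommGroup V] [Module ℝ V] [FiniteDimensional ℝ V]
  {B : LinearMap.BilinForm ℝ V} {T S W L : Submodule ℝ V}

/-- `V = (S ⊥ W) ⊥ (Rad T ⊕ L)`: the decomposition that makes the projections onto the tangent
space, the null transversal space and the screen transversal space meaningful. -/
theorem exists_decomposition (hB : ∀ v w, B v w = B w v) (hnd : B.Nondegenerate)
    (hS : Disjoint (T ⊓ B.orthogonal T) S) (hS' : (T ⊓ B.orthogonal T) ⊔ S = T)
    (hW : Disjoint (T ⊓ B.orthogonal T) W) (hW' : (T ⊓ B.orthogonal T) ⊔ W = B.orthogonal T)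
    (hLL : ∀ v ∈ L, ∀ w ∈ L, B v w = 0)
    (hL : (T ⊓ B.orthogonal T) ⊔ L = B.orthogonal S ⊓ B.orthogonal W) :
    IsCompl T (L ⊔ W) ∧ IsCompl W (T ⊔ L) := by
  have hrefl : B.IsRefl := fun v w h => by rw [hB]; exact h
  have hST : S ≤ T := hS' ▸ le_sup_right
  have hWT : W ≤ B.orthogonal T := hW' ▸ le_sup_right
  have hLS : L ≤ B.orthogonal S ⊓ B.orthogonal W := hL ▸ le_sup_right
  have hTT : B.orthogonal (B.orthogonal T) = T :=
    LinearMap.BilinForm.orthogonal_orthogonal hnd hrefl T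
  -- `S ⊔ W` is nondegenerate
  have hdisj : Disjoint (S ⊔ W) (B.orthogonal (S ⊔ W)) := by
    rw [Submodule.disjoint_def]
    intro x hx hx'
    obtain ⟨s, hs, w, hw, rfl⟩ := Submodule.mem_sup.1 hx
    have horth : ∀ y ∈ S ⊔ W, B y (s + w) = 0 := fun y hy => hx' y hy
    have hs0 : s = 0 := by
      refine Submodule.disjoint_def.1 hS s ⟨hST hs, ?_⟩ hs
      intro t ht
      rw [← hS'] at ht
      obtain ⟨r, hr, s', hs', rfl⟩ := Submodule.mem_sup.1 ht
      have h1 : B r s = 0 := by rw [hB]; exact hr.2 s (hST hs)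
      have h2 : B s' w = 0 := hWT hw s' (hST hs')
      have h3 := horth s' (Submodule.mem_sup_left hs')
      simp only [map_add, LinearMap.add_apply] at h3 ⊢
      change B r s + B s' s = 0
      linarith
    have hw0 : w = 0 := by
      refine Submodule.disjoint_def.1 hW w ⟨?_, hWT hw⟩ hw
      rw [← hTT]
      intro t ht
      rw [← hW'] at ht
      obtain ⟨r, hr, w', hw', rfl⟩ := Submodule.mem_sup.1 ht
      have h1 : B r w = 0 := hWT hw r hr.1
      have h3 := horth w' (Submodule.mem_sup_right hw')
      rw [hs0, zero_add] at h3
      change B (r + w') w = 0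
      rw [map_add, LinearMap.add_apply, h1, h3, add_zero]
    rw [hs0, hw0, add_zero]
  have hcompl : IsCompl (S ⊔ W) (B.orthogonal (S ⊔ W)) :=
    (LinearMap.BilinForm.isCompl_orthogonal_iff_disjoint hrefl).2 hdisj
  have horth : B.orthogonal (S ⊔ W) = B.orthogonal S ⊓ B.orthogonal W := by
    ext v
    constructor
    · intro h
      exact ⟨fun y hy => h y (Submodule.mem_sup_left hy),
        fun y hy => h y (Submodule.mem_sup_right hy)⟩
    · rintro ⟨h1, h2⟩ y hy
      obtain ⟨s, hs, w, hw, rfl⟩ := Submodule.mem_sup.1 hy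
      have a1 : B s v = 0 := h1 s hs
      have a2 : B w v = 0 := h2 w hw
      change B (s + w) v = 0
      rw [map_add, LinearMap.add_apply, a1, a2, add_zero]
  have htop : T ⊔ L ⊔ W = ⊤ := by
    rw [eq_top_iff, ← hcompl.sup_eq_top, horth, ← hL]
    refine sup_le (sup_le ?_ le_sup_right) (sup_le ?_ ?_)
    · exact hST.trans (le_sup_left.trans le_sup_left)
    · exact inf_le_left.trans (le_sup_left.trans le_sup_left)
    · exact le_sup_right.trans le_sup_left
  -- a relation `t = l + w` is trivial
  have key : ∀ t ∈ T, ∀ l ∈ L, ∀ w ∈ W, t = l + w → l = 0 ∧ w = 0 := by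
    intro t ht l hl w hw h
    have hl0 : l = 0 := by
      refine hnd.1 l fun y => ?_
      have hy : y ∈ (S ⊔ W) ⊔ B.orthogonal (S ⊔ W) := hcompl.sup_eq_top ▸ Submodule.mem_top
      rw [horth, ← hL] at hy
      obtain ⟨a, ha, b, hb, rfl⟩ := Submodule.mem_sup.1 hy
      obtain ⟨s, hs, w', hw', rfl⟩ := Submodule.mem_sup.1 ha
      obtain ⟨r, hr, l', hl', rfl⟩ := Submodule.mem_sup.1 hb
      have b1 : B s l = 0 := (hLS hl).1 s hs
      have b2 : B w' l = 0 := (hLS hl).2 w' hw'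
      have b3 : B l' l = 0 := hLL l' hl' l hl
      have b4 : B r t = 0 := by rw [hB]; exact hr.2 t ht
      have b5 : B r w = 0 := hWT hw r hr.1
      have b6 : B r l = 0 := by
        have : l = t - w := by rw [h]; abel
        rw [this, map_sub, b4, b5, sub_zero]
      rw [hB]
      simp only [map_add, LinearMap.add_apply, b1, b2, b3, b6, add_zero]
    refine ⟨hl0, ?_⟩
    rw [hl0, zero_add] at h
    exact Submodule.disjoint_def.1 hW w ⟨h ▸ ht, hWT hw⟩ hw
  refine ⟨⟨?_, ?_⟩, ⟨?_, ?_⟩⟩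
  · rw [Submodule.disjoint_def]
    intro x hx hx'
    obtain ⟨l, hl, w, hw, h⟩ := Submodule.mem_sup.1 hx'
    obtain ⟨h1, h2⟩ := key x hx l hl w hw h.symm
    rw [← h, h1, h2, add_zero]
  · rw [codisjoint_iff, ← sup_assoc]; exact htop
  · rw [Submodule.disjoint_def]
    intro x hx hx'
    obtain ⟨t, ht, l, hl, h⟩ := Submodule.mem_sup.1 hx'
    exact (key t ht (-l) (L.neg_mem hl) x hx (by rw [← h]; abel)).2
  · rw [codisjoint_iff, sup_comm]; exact htop

end LinearAlgebra

/-! ### Vector fields, one-forms, exterior derivative, semi-Riemannian metrics -/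

section Real

variable {E : Type*} [NormedAddCommGroup E] [NormedSpace ℝ E]
  {P : Type*} [TopologicalSpace P] [ChartedSpace E P]
  {F : Type*} [NormedAddCommGroup F] [NormedSpace ℝ F]
  {M : Type*} [TopologicalSpace M] [ChartedSpace F M]

/-- The vector field `X` is smooth on a neighbourhood of `x`. -/
def SmoothNear [IsManifold 𝓘(ℝ, E) ∞ P] (X : Π y : P, TangentSpace 𝓘(ℝ, E) y) (x : P) : Prop :=
  ∀ᶠ y in 𝓝 x, ContMDiffAt 𝓘(ℝ, E) 𝓘(ℝ, E).tangent ∞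
    (fun z => (⟨z, X z⟩ : TangentBundle 𝓘(ℝ, E) P)) y

/-- The vector field `X` is smooth on the set `s`. -/
def SmoothFieldOn [IsManifold 𝓘(ℝ, E) ∞ P] (X : Π y : P, TangentSpace 𝓘(ℝ, E) y)
    (s : Set P) : Prop :=
  ContMDiffOn 𝓘(ℝ, E) 𝓘(ℝ, E).tangent ∞ (fun z => (⟨z, X z⟩ : TangentBundle 𝓘(ℝ, E) P)) s

/-- The real one-form `α` is smooth on the set `s`. -/
def SmoothFormOn [IsManifold 𝓘(ℝ, E) ∞ P] (α : Π y : P, TangentSpace 𝓘(ℝ, E) y →L[ℝ] ℝ)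
    (s : Set P) : Prop :=
  ContMDiffOn 𝓘(ℝ, E) (𝓘(ℝ, E).prod 𝓘(ℝ, E →L[ℝ] ℝ)) ∞
    (fun z => TotalSpace.mk' (E →L[ℝ] ℝ)
      (E := fun y : P => TangentSpace 𝓘(ℝ, E) y →L[ℝ] Trivial P ℝ y) z (α z)) s

/-- The `(1,1)`-tensor field `A` is smooth on the set `s`. -/
def SmoothEndOn [IsManifold 𝓘(ℝ, E) ∞ P]
    (A : Π y : P, TangentSpace 𝓘(ℝ, E) y →L[ℝ] TangentSpace 𝓘(ℝ, E) y) (s : Set P) : Prop :=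
  ContMDiffOn 𝓘(ℝ, E) (𝓘(ℝ, E).prod 𝓘(ℝ, E →L[ℝ] E)) ∞
    (fun z => TotalSpace.mk' (E →L[ℝ] E)
      (E := fun y : P => TangentSpace 𝓘(ℝ, E) y →L[ℝ] TangentSpace 𝓘(ℝ, E) y) z (A z)) s

/-- The exterior derivative of a (vector-valued) one-form, in the normalization
`2 dα(X, Y) = X(α(Y)) - Y(α(X)) - α([X, Y])`. -/
noncomputable def extDerivForm {A : Type*} [NormedAddCommGroup A] [NormedSpace ℝ A]
    (α : Π y : P, TangentSpace 𝓘(ℝ, E) y →L[ℝ] A)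
    (X Y : Π y : P, TangentSpace 𝓘(ℝ, E) y) (x : P) : A :=
  (1 / 2 : ℝ) • (mvfderiv 𝓘(ℝ, E) (fun y => α y (Y y)) x (X x)
    - mvfderiv 𝓘(ℝ, E) (fun y => α y (X y)) x (Y x)
    - α x (mlieBracket 𝓘(ℝ, E) X Y x))

/-- The wedge product of two one-forms, in the normalization
`2 (α ∧ β)(X, Y) = α(X) β(Y) - α(Y) β(X)` that goes with `extDerivForm`. -/
noncomputable def wedge (α β : Π y : P, TangentSpace 𝓘(ℝ, E) y →L[ℝ] ℝ)
    (X Y : Π y : P, TangentSpace 𝓘(ℝ, E) y) (x : P) : ℝ :=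
  (1 / 2 : ℝ) * (α x (X x) * β x (Y x) - α x (Y x) * β x (X x))

/-- The Nijenhuis tensor `[A, A](X, Y) = A²[X, Y] + [AX, AY] - A[AX, Y] - A[X, AY]`. -/
noncomputable def nijenhuis
    (A : Π y : P, TangentSpace 𝓘(ℝ, E) y →L[ℝ] TangentSpace 𝓘(ℝ, E) y)
    (X Y : Π y : P, TangentSpace 𝓘(ℝ, E) y) (x : P) : TangentSpace 𝓘(ℝ, E) x :=
  A x (A x (mlieBracket 𝓘(ℝ, E) X Y x))
    + mlieBracket 𝓘(ℝ, E) (fun y => A y (X y)) (fun y => A y (Y y)) x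
    - A x (mlieBracket 𝓘(ℝ, E) (fun y => A y (X y)) Y x)
    - A x (mlieBracket 𝓘(ℝ, E) X (fun y => A y (Y y)) x)

variable (E P) in
/-- A semi-Riemannian metric on `P`: a smooth field of nondegenerate symmetric bilinear forms. -/
structure SemiRiemannianMetric [IsManifold 𝓘(ℝ, E) ∞ P] where
  inner (x : P) : TangentSpace 𝓘(ℝ, E) x →L[ℝ] TangentSpace 𝓘(ℝ, E) x →L[ℝ] ℝ
  symm (x : P) (v w : TangentSpace 𝓘(ℝ, E) x) : inner x v w = inner x w v
  nondegenerate (x : P) (v : TangentSpace 𝓘(ℝ, E) x) : (∀ w, inner x v w = 0) → v = 0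
  contMDiff : ContMDiff 𝓘(ℝ, E) (𝓘(ℝ, E).prod 𝓘(ℝ, E →L[ℝ] E →L[ℝ] ℝ)) ∞
    (fun x => TotalSpace.mk' (E →L[ℝ] E →L[ℝ] ℝ)
      (E := fun y : P => TangentSpace 𝓘(ℝ, E) y →L[ℝ] TangentSpace 𝓘(ℝ, E) y →L[ℝ] ℝ)
      x (inner x))

namespace SemiRiemannianMetric

variable [IsManifold 𝓘(ℝ, E) ∞ P] (g : SemiRiemannianMetric E P)

/-- The scalar product on the tangent space at `x` as a bilinear form. -/
noncomputable def bilin (x : P) : LinearMap.BilinForm ℝ (TangentSpace 𝓘(ℝ, E) x) :=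
  LinearMap.mk₂ ℝ (fun v w => g.inner x v w) (by simp) (by simp) (by simp) (by simp)

/-- The metric has constant index `ν`: the maximal dimension of a negative definite subspace of
each tangent space is `ν`. -/
def HasIndex (ν : ℕ) : Prop :=
  ∀ x : P, sigNeg (LinearMap.BilinMap.toQuadraticMap (g.bilin x)) = ν

/-- The metric in the chart at `x`, as a function on the model space. -/
noncomputable def coord (x : P) (e : E) : E →L[ℝ] E →L[ℝ] ℝ :=
  letI A : E →L[ℝ] E := mfderiv 𝓘(ℝ, E) 𝓘(ℝ, E) (extChartAt 𝓘(ℝ, E) x).symm e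
  letI G : E →L[ℝ] E →L[ℝ] ℝ := g.inner ((extChartAt 𝓘(ℝ, E) x).symm e)
  G.bilinearComp A A

set_option synthInstance.maxHeartbeats 200000 in
/-- The Christoffel symbols of the metric at `x` in the chart at `x`: `Γ(a, b)` is the vector with
`2 g(Γ(a, b), c) = ∂_a g(b, c) + ∂_b g(a, c) - ∂_c g(a, b)` for all `c`.
(`TangentSpace 𝓘(ℝ, E) x` is `E`, the chart at `x` having the identity as derivative at `x`.) -/
noncomputable def christoffel (x : P) (a b : E) : E :=
  letI G : E →L[ℝ] E →L[ℝ] ℝ := g.inner x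
  letI D : E →L[ℝ] E →L[ℝ] E →L[ℝ] ℝ := fderiv ℝ (g.coord x) (extChartAt 𝓘(ℝ, E) x x)
  G.inverse ((1 / 2 : ℝ) • (D a b + D b a - (D.flip a).flip b))

set_option synthInstance.maxHeartbeats 200000 in
/-- The defining property of the Christoffel symbols. -/
theorem inner_christoffel [FiniteDimensional ℝ E] (x : P) (a b c : E) :
    g.inner x (g.christoffel x a b) c =
      (1 / 2 : ℝ) * (fderiv ℝ (g.coord x) (extChartAt 𝓘(ℝ, E) x x) a b c
        + fderiv ℝ (g.coord x) (extChartAt 𝓘(ℝ, E) x x) b a c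
        - fderiv ℝ (g.coord x) (extChartAt 𝓘(ℝ, E) x x) c a b) := by
  set D : E →L[ℝ] E →L[ℝ] E →L[ℝ] ℝ := fderiv ℝ (g.coord x) (extChartAt 𝓘(ℝ, E) x x) with hD
  let G : E →L[ℝ] E →L[ℝ] ℝ := g.inner x
  have hinj : Function.Injective G.toLinearMap := by
    rw [injective_iff_map_eq_zero]
    intro v hv
    exact g.nondegenerate x v fun w => DFunLike.congr_fun hv w
  have hdim : Module.finrank ℝ E = Module.finrank ℝ (E →L[ℝ] ℝ) := by
    rw [← LinearMap.toContinuousLinearMap.finrank_eq]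
    exact Subspace.dual_finrank_eq.symm
  let e : E ≃L[ℝ] (E →L[ℝ] ℝ) :=
    (LinearEquiv.ofInjectiveOfFinrankEq G.toLinearMap hinj hdim).toContinuousLinearEquiv
  have he : G = (e : E →L[ℝ] (E →L[ℝ] ℝ)) := by ext; rfl
  have hG : ∀ α : E →L[ℝ] ℝ, G (G.inverse α) = α := by
    intro α
    rw [he, ContinuousLinearMap.inverse_equiv]
    simp
  change G (G.inverse ((1 / 2 : ℝ) • (D a b + D b a - (D.flip a).flip b))) c = _
  rw [hG]
  simp

/-- The Levi-Civita covariant derivative `∇̄_v Y` of a vector field `Y` along a map `f : M → P`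
in the direction `v ∈ T_x M`: in the chart of `P` at `f x` it is `v(Y^k) + Γ^k_{ij} (df v)^i Y^j`.
For `f = id` this is the Levi-Civita connection of `P`; if `Y = Ỹ ∘ f`, it is
`(∇̄_{df v} Ỹ)(f x)`. -/
noncomputable def covDeriv (f : M → P) (Y : Π y : M, TangentSpace 𝓘(ℝ, E) (f y)) (x : M)
    (v : TangentSpace 𝓘(ℝ, F) x) : TangentSpace 𝓘(ℝ, E) (f x) :=
  letI Yc : M → E := fun y =>
    mfderiv 𝓘(ℝ, E) 𝓘(ℝ, E) (extChartAt 𝓘(ℝ, E) (f x)) (f y) (Y y)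
  letI dY : F →L[ℝ] E := mvfderiv 𝓘(ℝ, F) Yc x
  letI df : F →L[ℝ] E := mfderiv 𝓘(ℝ, F) 𝓘(ℝ, E) f x
  (dY v + g.christoffel (f x) (df v) (Y x) : E)

end SemiRiemannianMetric

/-! ### Null submanifolds -/

/-- `D` is a smooth vector subbundle of rank `k` of the pullback of the tangent bundle of `P` along
`f`: near every point it is spanned by `k` smooth pointwise linearly independent sections. -/
def IsSmoothSubbundle [IsManifold 𝓘(ℝ, E) ∞ P] (f : M → P)
    (D : Π x : M, Submodule ℝ (TangentSpace 𝓘(ℝ, E) (f x))) (k : ℕ) : Prop :=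
  ∀ x₀ : M, ∃ s : Fin k → Π x : M, TangentSpace 𝓘(ℝ, E) (f x), ∀ᶠ x in 𝓝 x₀,
    (∀ j, ContMDiffAt 𝓘(ℝ, F) 𝓘(ℝ, E).tangent ∞
      (fun y => (⟨f y, s j y⟩ : TangentBundle 𝓘(ℝ, E) P)) x) ∧
    LinearIndependent ℝ (fun j => s j x) ∧ Submodule.span ℝ (range fun j => s j x) = D x

/-- The tangent space `T_x M` as a subspace of `T_{f x} P`. -/
noncomputable def tangentSub (f : M → P) (x : M) : Submodule ℝ (TangentSpace 𝓘(ℝ, E) (f x)) :=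
  LinearMap.range (mfderiv 𝓘(ℝ, F) 𝓘(ℝ, E) f x).toLinearMap

variable [IsManifold 𝓘(ℝ, E) ∞ P]

/-- The normal space `T_x M^⊥` in `T_{f x} P`. -/
noncomputable def normalSub (g : SemiRiemannianMetric E P) (f : M → P) (x : M) :
    Submodule ℝ (TangentSpace 𝓘(ℝ, E) (f x)) :=
  (g.bilin (f x)).orthogonal (tangentSub (F := F) f x)

/-- The radical `Rad T_x M = T_x M ∩ T_x M^⊥`. -/
noncomputable def radical (g : SemiRiemannianMetric E P) (f : M → P) (x : M) :
    Submodule ℝ (TangentSpace 𝓘(ℝ, E) (f x)) :=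
  tangentSub (F := F) f x ⊓ normalSub (F := F) g f x

/-- An `r`-null submanifold, `r > 0`, immersed in `P` by `f`, together with a choice of screen
distribution `S(TM)`, screen transversal bundle `S(TM^⊥)` and null transversal bundle `ltr(TM)`. -/
structure NullSubmanifold (F : Type*) [NormedAddCommGroup F] [NormedSpace ℝ F]
    {M : Type*} [TopologicalSpace M] [ChartedSpace F M]
    (g : SemiRiemannianMetric E P) (f : M → P) (r : ℕ) where
  smooth : ContMDiff 𝓘(ℝ, F) 𝓘(ℝ, E) ∞ f
  immersion : ∀ x, Function.Injective (mfderiv 𝓘(ℝ, F) 𝓘(ℝ, E) f x)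
  r_pos : 0 < r
  radical_smooth : IsSmoothSubbundle (F := F) f (radical (F := F) g f) r
  /-- the screen distribution `S(TM)`, a complement of the radical in the tangent bundle -/
  screen : Π x : M, Submodule ℝ (TangentSpace 𝓘(ℝ, E) (f x))
  screen_smooth : ∃ k, IsSmoothSubbundle (F := F) f screen k
  screen_disjoint : ∀ x, Disjoint (radical (F := F) g f x) (screen x)
  screen_sup : ∀ x, radical (F := F) g f x ⊔ screen x = tangentSub (F := F) f x
  /-- the screen transversal bundle `S(TM^⊥)`, a complement of the radical in the normal bundle -/
  screenTr : Π x : M, Submodule ℝ (TangentSpace 𝓘(ℝ, E) (f x))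
  screenTr_smooth : ∃ k, IsSmoothSubbundle (F := F) f screenTr k
  screenTr_disjoint : ∀ x, Disjoint (radical (F := F) g f x) (screenTr x)
  screenTr_sup : ∀ x, radical (F := F) g f x ⊔ screenTr x = normalSub (F := F) g f x
  /-- the null transversal bundle `ltr(TM)`: a null complement of the radical in the orthogonal
  complement of `S(TM^⊥)` in `S(TM)^⊥`; equivalently, it is locally spanned by the null frames
  `N_j` of that bundle with `g(ξ_i, N_j) = δ_ij`, for the local frames `ξ_i` of the radical -/
  nullTr : Π x : M, Submodule ℝ (TangentSpace 𝓘(ℝ, E) (f x))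
  nullTr_smooth : IsSmoothSubbundle (F := F) f nullTr r
  nullTr_null : ∀ x, ∀ v ∈ nullTr x, ∀ w ∈ nullTr x, g.inner (f x) v w = 0
  nullTr_disjoint : ∀ x, Disjoint (radical (F := F) g f x) (nullTr x)
  nullTr_sup : ∀ x, radical (F := F) g f x ⊔ nullTr x =
    (g.bilin (f x)).orthogonal (screen x) ⊓ (g.bilin (f x)).orthogonal (screenTr x)

namespace NullSubmanifold

variable {g : SemiRiemannianMetric E P} {f : M → P} {r : ℕ}

theorem decomposition [FiniteDimensional ℝ E] (N : NullSubmanifold F g f r) (x : M) :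
    IsCompl (tangentSub (F := F) f x) (N.nullTr x ⊔ N.screenTr x) ∧
      IsCompl (N.screenTr x) (tangentSub (F := F) f x ⊔ N.nullTr x) := by
  have : FiniteDimensional ℝ (TangentSpace 𝓘(ℝ, E) (f x)) :=
    inferInstanceAs (FiniteDimensional ℝ E)
  refine exists_decomposition (B := g.bilin (f x)) (S := N.screen x) (g.symm (f x)) ?_
    (N.screen_disjoint x) (N.screen_sup x) (N.screenTr_disjoint x) (N.screenTr_sup x)
    (N.nullTr_null x) (N.nullTr_sup x)
  exact ⟨fun v h => g.nondegenerate (f x) v h,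
    fun v h => g.nondegenerate (f x) v fun w => by rw [g.symm]; exact h w⟩

/-- `∇̄_X Y` for vector fields `X`, `Y` on `M`, a vector field along `f`. -/
noncomputable def ambientDeriv (_N : NullSubmanifold F g f r)
    (X Y : Π y : M, TangentSpace 𝓘(ℝ, F) y) (x : M) : TangentSpace 𝓘(ℝ, E) (f x) :=
  g.covDeriv f (fun y => mfderiv 𝓘(ℝ, F) 𝓘(ℝ, E) f y (Y y)) x (X x)

variable [FiniteDimensional ℝ E]

/-- The induced connection: `∇_X Y` is the tangential part of `∇̄_X Y` with respect to
`TP = TM ⊕ tr(TM)`, `tr(TM) = ltr(TM) ⊥ S(TM^⊥)`. -/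
noncomputable def inducedConnection (N : NullSubmanifold F g f r)
    (X Y : Π y : M, TangentSpace 𝓘(ℝ, F) y) (x : M) : TangentSpace 𝓘(ℝ, F) x :=
  LinearMap.linearProjOfIsCompl (N.nullTr x ⊔ N.screenTr x)
    (mfderiv 𝓘(ℝ, F) 𝓘(ℝ, E) f x).toLinearMap (N.immersion x) (N.decomposition x).1
    (N.ambientDeriv X Y x)

/-- The screen second fundamental form: `h^s(X, Y)` is the `S(TM^⊥)`-part of `∇̄_X Y` with respect
to `TP = TM ⊕ ltr(TM) ⊕ S(TM^⊥)`. -/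
noncomputable def hs (N : NullSubmanifold F g f r)
    (X Y : Π y : M, TangentSpace 𝓘(ℝ, F) y) (x : M) : TangentSpace 𝓘(ℝ, E) (f x) :=
  (N.screenTr x).projection (tangentSub (F := F) f x ⊔ N.nullTr x) (N.decomposition x).2
    (N.ambientDeriv X Y x)

/-- The induced (degenerate) metric on `M`. -/
noncomputable def inducedMetric (_N : NullSubmanifold F g f r) (x : M)
    (v w : TangentSpace 𝓘(ℝ, F) x) : ℝ :=
  g.inner (f x) (mfderiv 𝓘(ℝ, F) 𝓘(ℝ, E) f x v) (mfderiv 𝓘(ℝ, F) 𝓘(ℝ, E) f x w)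

/-- The induced connection is a metric connection: `(∇_X g)(Y, Z) = 0` at every point, for all
vector fields `X`, `Y`, `Z` on `M`, smooth near that point. -/
def IsMetricConnection [IsManifold 𝓘(ℝ, F) ∞ M] (N : NullSubmanifold F g f r) : Prop :=
  ∀ (x : M) (X Y Z : Π y : M, TangentSpace 𝓘(ℝ, F) y),
    SmoothNear X x → SmoothNear Y x → SmoothNear Z x →
    mvfderiv 𝓘(ℝ, F) (fun y => N.inducedMetric y (Y y) (Z y)) x (X x)
      - N.inducedMetric x (N.inducedConnection X Y x) (Z x)
      - N.inducedMetric x (Y x) (N.inducedConnection X Z x) = 0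

end NullSubmanifold

end Real

/-! ### Complex contact manifolds -/

section Complex

variable {E : Type*} [NormedAddCommGroup E] [NormedSpace ℂ E]
  {P : Type*} [TopologicalSpace P] [ChartedSpace E P]

/-- A complex manifold is a smooth manifold. -/
instance realManifold [h : IsManifold 𝓘(ℂ, E) ∞ P] : IsManifold 𝓘(ℝ, E) ∞ P := by
  refine isManifold_of_contDiffOn _ _ _ fun e e' he he' => ?_
  exact ((contDiffGroupoid ∞ 𝓘(ℂ, E)).compatible he he').1.restrict_scalars ℝ

/-- The complex structure `J` of a complex manifold: multiplication by `i` in holomorphic charts. -/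
noncomputable def J (x : P) : TangentSpace 𝓘(ℝ, E) x →L[ℝ] TangentSpace 𝓘(ℝ, E) x :=
  (ContinuousLinearMap.lsmul ℝ ℂ Complex.I : E →L[ℝ] E)

/-- A complex-linear one-form regarded as a complex-valued form on the real tangent bundle. -/
noncomputable def realForm (θ : Π x : P, TangentSpace 𝓘(ℂ, E) x →L[ℂ] ℂ) (x : P) :
    TangentSpace 𝓘(ℝ, E) x →L[ℝ] ℂ :=
  (θ x : E →L[ℂ] ℂ).restrictScalars ℝ

/-- `(θ ∧ (dθ)^n)(X₀, …, X₂ₙ)`, up to a nonzero constant that depends on the normalization of the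
wedge product and the exterior derivative. -/
noncomputable def contactVolume (n : ℕ) (θ : Π x : P, TangentSpace 𝓘(ℂ, E) x →L[ℂ] ℂ)
    (X : Fin (2 * n + 1) → Π x : P, TangentSpace 𝓘(ℝ, E) x) (x : P) : ℂ :=
  ∑ s : Equiv.Perm (Fin (2 * n + 1)), ((Equiv.Perm.sign s : ℤ) : ℂ) *
    (realForm θ x (X (s 0) x) * ∏ k : Fin n,
      extDerivForm (realForm θ) (X (s ⟨2 * k + 1, by omega⟩)) (X (s ⟨2 * k + 2, by omega⟩)) x)

variable [IsManifold 𝓘(ℂ, E) ∞ P]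

variable (E P) in
/-- A complex contact structure on a complex manifold of complex dimension `2n + 1`. -/
structure ComplexContactStructure (ι : Type*) (n : ℕ) where
  finrank_eq : Module.finrank ℂ E = 2 * n + 1
  /-- the open covering -/
  O : ι → Set P
  isOpen : ∀ i, IsOpen (O i)
  cover : ∀ x, ∃ i, x ∈ O i
  /-- the local holomorphic contact forms -/
  θ : ι → Π x : P, TangentSpace 𝓘(ℂ, E) x →L[ℂ] ℂ
  holomorphic : ∀ i, ContMDiffOn 𝓘(ℂ, E) (𝓘(ℂ, E).prod 𝓘(ℂ, E →L[ℂ] ℂ)) ∞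
    (fun z => TotalSpace.mk' (E →L[ℂ] ℂ)
      (E := fun y : P => TangentSpace 𝓘(ℂ, E) y →L[ℂ] Trivial P ℂ y) z (θ i z)) (O i)
  contact : ∀ i, ∀ x ∈ O i, ∃ X : Fin (2 * n + 1) → Π y : P, TangentSpace 𝓘(ℝ, E) y,
    (∀ k, SmoothNear (X k) x) ∧ contactVolume n (θ i) X x ≠ 0
  transition : ∀ i j, ∃ h : P → ℂ, ContMDiffOn 𝓘(ℂ, E) 𝓘(ℂ, ℂ) ∞ h (O i ∩ O j) ∧
    ∀ x ∈ O i ∩ O j, h x ≠ 0 ∧ θ i x = h x • θ j x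

variable (E P) in
/-- A complex contact metric structure `(u, v, U, V, G, H, g)` with a semi-Riemannian metric `g`.
All tensor fields with an index `i` are meaningful on `O i` only. -/
structure ComplexContactMetricStructure (ι : Type*) (n : ℕ)
    extends ComplexContactStructure E P ι n where
  /-- the metric, Hermitian with respect to `J` -/
  g : SemiRiemannianMetric E P
  hermitian : ∀ x (a b : TangentSpace 𝓘(ℝ, E) x), g.inner x (J x a) (J x b) = g.inner x a b
  u : ι → Π x : P, TangentSpace 𝓘(ℝ, E) x →L[ℝ] ℝ
  v : ι → Π x : P, TangentSpace 𝓘(ℝ, E) x →L[ℝ] ℝ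
  U : ι → Π x : P, TangentSpace 𝓘(ℝ, E) x
  V : ι → Π x : P, TangentSpace 𝓘(ℝ, E) x
  G : ι → Π x : P, TangentSpace 𝓘(ℝ, E) x →L[ℝ] TangentSpace 𝓘(ℝ, E) x
  H : ι → Π x : P, TangentSpace 𝓘(ℝ, E) x →L[ℝ] TangentSpace 𝓘(ℝ, E) x
  σ : ι → Π x : P, TangentSpace 𝓘(ℝ, E) x →L[ℝ] ℝ
  smooth : ∀ i, SmoothFormOn (u i) (O i) ∧ SmoothFormOn (v i) (O i) ∧
    SmoothFieldOn (U i) (O i) ∧ SmoothFieldOn (V i) (O i) ∧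
    SmoothEndOn (G i) (O i) ∧ SmoothEndOn (H i) (O i) ∧ SmoothFormOn (σ i) (O i)
  v_eq : ∀ i, ∀ x ∈ O i, ∀ a, v i x a = u i x (J x a)
  V_eq : ∀ i, ∀ x ∈ O i, V i x = - J x (U i x)
  H_eq : ∀ i, ∀ x ∈ O i, ∀ a, H i x a = G i x (J x a)
  G_sq : ∀ i, ∀ x ∈ O i, ∀ a, G i x (G i x a) = -a + u i x a • U i x + v i x a • V i x
  H_sq : ∀ i, ∀ x ∈ O i, ∀ a, H i x (H i x a) = -a + u i x a • U i x + v i x a • V i x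
  G_skew : ∀ i, ∀ x ∈ O i, ∀ a b, g.inner x (G i x a) b = - g.inner x a (G i x b)
  U_dual : ∀ i, ∀ x ∈ O i, ∀ a, g.inner x (U i x) a = u i x a
  G_J : ∀ i, ∀ x ∈ O i, ∀ a, G i x (J x a) = - J x (G i x a)
  G_U : ∀ i, ∀ x ∈ O i, G i x (U i x) = 0
  u_U : ∀ i, ∀ x ∈ O i, u i x (U i x) = 1
  /-- the change of the local tensors on overlaps -/
  overlap : ∀ i j, ∃ a b : P → ℝ, ∀ x ∈ O i ∩ O j, a x ^ 2 + b x ^ 2 = 1 ∧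
    u j x = a x • u i x - b x • v i x ∧ v j x = b x • u i x + a x • v i x ∧
    G j x = a x • G i x - b x • H i x ∧ H j x = b x • G i x + a x • H i x
  /-- the contact form is `u - i v` up to a nonvanishing complex-valued function -/
  contactForm : ∀ i, ∃ h : P → ℂ, ∀ x ∈ O i, h x ≠ 0 ∧
    ∀ a, realForm (θ i) x a = h x * ((u i x a : ℂ) - Complex.I * (v i x a : ℂ))
  du : ∀ i, ∀ x ∈ O i, ∀ X Y : Π y : P, TangentSpace 𝓘(ℝ, E) y, SmoothNear X x → SmoothNear Y x →
    extDerivForm (u i) X Y x = g.inner x (X x) (G i x (Y x)) + wedge (σ i) (v i) X Y x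
  dv : ∀ i, ∀ x ∈ O i, ∀ X Y : Π y : P, TangentSpace 𝓘(ℝ, E) y, SmoothNear X x → SmoothNear Y x →
    extDerivForm (v i) X Y x = g.inner x (X x) (H i x (Y x)) - wedge (σ i) (u i) X Y x

namespace ComplexContactMetricStructure

variable {ι : Type*} {n : ℕ} (C : ComplexContactMetricStructure E P ι n)

/-- The tensor `S` that enters the normality condition. -/
noncomputable def tensorS (i : ι) (X Y : Π y : P, TangentSpace 𝓘(ℝ, E) y) (x : P) :
    TangentSpace 𝓘(ℝ, E) x :=
  nijenhuis (C.G i) X Y x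
    + (2 * C.g.inner x (X x) (C.G i x (Y x))) • C.U i x
    - (2 * C.g.inner x (X x) (C.H i x (Y x))) • C.V i x
    + (2 : ℝ) • (C.v i x (Y x) • C.H i x (X x) - C.v i x (X x) • C.H i x (Y x))
    + C.σ i x (C.G i x (Y x)) • C.H i x (X x)
    - C.σ i x (C.G i x (X x)) • C.H i x (Y x)
    + C.σ i x (X x) • C.G i x (C.H i x (Y x))
    - C.σ i x (Y x) • C.G i x (C.H i x (X x))

/-- The tensor `T` that enters the normality condition. -/
noncomputable def tensorT (i : ι) (X Y : Π y : P, TangentSpace 𝓘(ℝ, E) y) (x : P) :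
    TangentSpace 𝓘(ℝ, E) x :=
  nijenhuis (C.H i) X Y x
    - (2 * C.g.inner x (X x) (C.G i x (Y x))) • C.U i x
    + (2 * C.g.inner x (X x) (C.H i x (Y x))) • C.V i x
    + (2 : ℝ) • (C.u i x (Y x) • C.G i x (X x) - C.u i x (X x) • C.G i x (Y x))
    + C.σ i x (C.H i x (X x)) • C.G i x (Y x)
    - C.σ i x (C.H i x (Y x)) • C.G i x (X x)
    + C.σ i x (X x) • C.G i x (C.H i x (Y x))
    - C.σ i x (Y x) • C.G i x (C.H i x (X x))

/-- `X` is, near `x`, a section of the horizontal subbundle `ker u ∩ ker v`. -/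
def HorizontalNear (i : ι) (X : Π y : P, TangentSpace 𝓘(ℝ, E) y) (x : P) : Prop :=
  ∀ᶠ y in 𝓝 x, C.u i y (X y) = 0 ∧ C.v i y (X y) = 0

/-- Normality: `S` and `T` vanish on horizontal vector fields, and `S(U, ·) = T(V, ·) = 0`. -/
def IsNormal : Prop :=
  ∀ i, ∀ x ∈ C.O i,
    (∀ X Y : Π y : P, TangentSpace 𝓘(ℝ, E) y, SmoothNear X x → SmoothNear Y x →
      C.HorizontalNear i X x → C.HorizontalNear i Y x →
      C.tensorS i X Y x = 0 ∧ C.tensorT i X Y x = 0) ∧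
    (∀ X : Π y : P, TangentSpace 𝓘(ℝ, E) y, SmoothNear X x →
      C.tensorS i (C.U i) X x = 0 ∧ C.tensorT i (C.V i) X x = 0)

/-- The three structure tensors `J₁ = J`, `J₂ = G`, `J₃ = H` (numbered from `0`). -/
noncomputable def tensorJ (i : ι) (a : Fin 3) (x : P) :
    TangentSpace 𝓘(ℝ, E) x →L[ℝ] TangentSpace 𝓘(ℝ, E) x :=
  ![J x, C.G i x, C.H i x] a

end ComplexContactMetricStructure

namespace NullSubmanifold

variable {F : Type*} [NormedAddCommGroup F] [NormedSpace ℝ F]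
  {M : Type*} [TopologicalSpace M] [ChartedSpace F M]
  {ι : Type*} {n r : ℕ} {C : ComplexContactMetricStructure E P ι n} {f : M → P}

/-- The image `J_a S(TM)` of the screen distribution at `x`. -/
noncomputable def imageScreen (N : NullSubmanifold F C.g f r) (i : ι) (a : Fin 3) (x : M) :
    Submodule ℝ (TangentSpace 𝓘(ℝ, E) (f x)) :=
  (N.screen x).map (C.tensorJ i a (f x)).toLinearMap

/-- Screen real null submanifolds: the characteristic subbundle `span {U, V}` lies in `S(TM^⊥)`,
`J_a Rad TM = Rad TM` and `J_a S(TM) ⊆ S(TM^⊥)` for `a = 1, 2, 3`. -/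
def IsScreenReal (N : NullSubmanifold F C.g f r) : Prop :=
  ∀ i x, f x ∈ C.O i →
    C.U i (f x) ∈ N.screenTr x ∧ C.V i (f x) ∈ N.screenTr x ∧
    ∀ a : Fin 3,
      (radical (F := F) C.g f x).map (C.tensorJ i a (f x)).toLinearMap = radical (F := F) C.g f x ∧
      N.imageScreen i a x ≤ N.screenTr x

/-- `h^s(X, ξ)` has no component in `J_a S(TM)`, for all vector fields `X` and sections `ξ` of the
radical. As `J_a S(TM)` is a nondegenerate subbundle of `S(TM^⊥)`, the component of a vector in it
is its orthogonal projection, which is zero if and only if the vector is orthogonal to it. -/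
def NoScreenComponent [IsManifold 𝓘(ℝ, F) ∞ M] [FiniteDimensional ℝ E]
    (N : NullSubmanifold F C.g f r) (a : Fin 3) : Prop :=
  ∀ i x, f x ∈ C.O i → ∀ X ξ : Π y : M, TangentSpace 𝓘(ℝ, F) y,
    SmoothNear X x → SmoothNear ξ x →
    (∀ᶠ y in 𝓝 x, mfderiv 𝓘(ℝ, F) 𝓘(ℝ, E) f y (ξ y) ∈ radical (F := F) C.g f y) →
    N.hs X ξ x ∈ (C.g.bilin (f x)).orthogonal (N.imageScreen i a x)

end NullSubmanifold

end Complex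

end NullGeometry

/-!
Write `X(g(Y, Z))` through the Levi-Civita connection `∇̄` and split `∇̄_X Y` along
`TM ⊕ ltr(TM) ⊕ S(TM^⊥)`. Only the `ltr(TM)` part can spoil `∇g = 0`, and it pairs only with the
radical, so `(∇_X g)(Y, Z) = g(∇̄_X Y, η_Z) + g(∇̄_X Z, η_Y)`, where `η_Y`, `η_Z` are the radical
parts of `Y`, `Z` (`NullSubmanifold.nabla_metric`). If `ζ` is a section of the radical, then
`g(Y, ζ) = 0`, hence `g(∇̄_X Y, ζ) = -g(Y, ∇̄_X ζ)`
(`NullSubmanifold.inner_ambientDeriv_radical`). Since `J_m` maps the radical onto itself, one may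
take `ζ = J_m ξ` with `ξ` a section of the radical.

The point is that for `s ∈ S(TM)` one has `g(s, ∇̄_X(J_m ξ)) = -g(J_m s, h^s(X, ξ))`
(`NullSubmanifold.inner_screen_covDeriv`). This needs `g(s, (∇̄_X J_m) ξ) = 0`, and here normality
enters: on the horizontal space `ker u ∩ ker v` it forces, modulo the orthogonal complement of that
space,
`(∇̄_a G) b = σ(a) H b`, `(∇̄_a H) b = -σ(a) G b`, `(∇̄_a J) b = 0`.
Vectors tangent to `M` are horizontal because `U, V ∈ S(TM^⊥)`, and `J_k ξ` lies in the radical, so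
it is orthogonal to `s`.

Consequently, if `∇` is metric, `(∇_X g)(Y, Z) = 0` with `Y = s` in the screen and `Z = J_m ξ` at a
point says `g(J_m s, h^s(X, ξ)) = 0`. Conversely, if this product always vanishes, the screen parts
of `Y` and `Z` drop out of `(∇_X g)(Y, Z)`, which becomes `-X(g(ζ, ζ'))` for sections `ζ`, `ζ'` of
the radical that extend `η_Y`, `η_Z`; as the radical is null, this is zero.

The three formulas are proved as the corresponding fact of Kähler geometry
(`SemiRiemannianMetric.inner_covTensor_of_normal`): `d(du) = 0` gives the cyclic sum of `∇̄G` over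
horizontal vectors, `S = 0` gives its Nijenhuis combination, and together with the symmetries of
`∇̄G` these determine it. The pair `(v, -u, H, -G)` satisfies the same equations, which gives `∇̄H`,
and `∇̄J` follows from `H = GJ`. All derivatives are computed in the chart at the point, whose
derivative there is the identity.
-/

namespace NullGeometry

/-! ### Tensor identities at a point -/

section Pointwise

variable {E : Type*} [NormedAddCommGroup E] [NormedSpace ℝ E]

/-- The linear algebra behind `∇K = σ ⊗ K'`. Here `h` is the horizontal space, `A x` stands for
`∇_x K` and the two data on `A` are the cyclic sum `hcyc` (the exterior derivative of the
fundamental form `g(·, K·)`) and the Nijenhuis tensor `hN`. As in Kähler geometry, comparing the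
cyclic sums at `(a, b, c)` and at `(a, K b, K c)` leaves `2 g(A a b, c)` and a Nijenhuis term. -/
theorem covariant_formula_of_nijenhuis {g : E →L[ℝ] E →L[ℝ] ℝ} {K K' : E →L[ℝ] E}
    {A : E → E → E} {σ : E →L[ℝ] ℝ} {h : Submodule ℝ E}
    (hg : ∀ a b, g a b = g b a)
    (hK : ∀ a ∈ h, K a ∈ h) (hKK : ∀ a ∈ h, K (K a) = -a)
    (hskew : ∀ a b, g (K a) b = -g a (K b))
    (hskew' : ∀ a b, g (K' a) b = -g a (K' b))
    (hanti : ∀ a ∈ h, K' (K a) = -K (K' a))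
    (hA : ∀ x, ∀ a ∈ h, ∀ b ∈ h, g (A x a) b = -g a (A x b))
    (hAK : ∀ x, ∀ a ∈ h, ∀ b ∈ h, g (A x a) (K b) = -g (K a) (A x b))
    (hcyc : ∀ a ∈ h, ∀ b ∈ h, ∀ c ∈ h, g (A a b) c + g (A b c) a + g (A c a) b =
      -(σ a * g b (K' c) + σ b * g c (K' a) + σ c * g a (K' b)))
    (hN : ∀ a ∈ h, ∀ b ∈ h, ∀ w ∈ h, g w (A (K a) b - A (K b) a - K (A a b) + K (A b a)
      + σ (K b) • K' a - σ (K a) • K' b + σ a • K (K' b) - σ b • K (K' a)) = 0)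
    {a b c : E} (ha : a ∈ h) (hb : b ∈ h) (hc : c ∈ h) :
    g (A a b) c = σ a * g (K' b) c := by
  have h1 := hN b hb c hc (K a) (hK a ha)
  simp only [map_add, map_sub, map_smul, smul_eq_mul] at h1
  have key : ∀ a ∈ h, ∀ w, g (K a) (K w) = g a w := fun a ha w => by
    have := hskew w (K a)
    rw [hKK a ha, map_neg] at this
    rw [hg, this, hg a w]; ring
  rw [key a ha, key a ha, key a ha, key a ha] at h1
  have h2 := hcyc a ha b hb c hc
  have h3 := hcyc a ha (K b) (hK b hb) (K c) (hK c hc)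
  have e1 : g (A a (K b)) (K c) = - g (A a b) c := by
    have := hAK a (K b) (hK b hb) c hc
    rw [hKK b hb, ContinuousLinearMap.map_neg₂] at this
    linarith [hA a b hb c hc]
  have e2 : g (A (K b) (K c)) a = g (K a) (A (K b) c) := by
    rw [hA (K b) (K c) (hK c hc) a ha, hg (K c), hAK (K b) a ha c hc, neg_neg]
  have e3 : g (A (K c) a) (K b) = - g (K a) (A (K c) b) := hAK (K c) a ha b hb
  have e4 : g (K' b) c = - g b (K' c) := hskew' b c
  have e5 : g (K b) (K' (K c)) = - g b (K' c) := by rw [hanti c hc, map_neg, key b hb]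
  have e6 : g (K c) (K' a) = - g (K a) (K' c) := by
    rw [hg, hskew', hanti c hc, map_neg, hskew, neg_neg]
  have e7 : g a (K' (K b)) = g (K a) (K' b) := by rw [hanti b hb, map_neg, hskew]
  have e8 : g (A c a) b = - g a (A c b) := hA c a ha b hb
  have e9 : g (A b c) a = g a (A b c) := hg _ _
  have e10 : g c (K' a) = - g a (K' c) := by rw [hg, hskew']
  rw [e1, e2, e3, e5, e6, e7] at h3
  rw [e8, e9, e10] at h2
  rw [e4]
  linear_combination (1 / 2 : ℝ) * h2 - (1 / 2 : ℝ) * h3 + (1 / 2 : ℝ) * h1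

end Pointwise

/-! ### The covariant derivative of an endomorphism field in coordinates -/

section Coordinates

variable {E : Type*} [NormedAddCommGroup E] [NormedSpace ℝ E]

/-- The covariant derivative `(∇_x K) a` at `e` of a field `K` of endomorphisms of a vector space,
for the connection with Christoffel symbols `Γ` at `e`. -/
noncomputable def covEnd (Γ : E → E → E) (K : E → E →L[ℝ] E) (e x a : E) : E :=
  fderiv ℝ K e x a + Γ x (K e a) - K e (Γ x a)

variable {e : E} {g : E → E →L[ℝ] E →L[ℝ] ℝ} {Γ : E → E → E} {K : E → E →L[ℝ] E}

theorem fderiv_bilin_apply (hg : DifferentiableAt ℝ g e) {s t : E → E}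
    (hs : DifferentiableAt ℝ s e) (ht : DifferentiableAt ℝ t e) (x : E) :
    fderiv ℝ (fun y => g y (s y) (t y)) e x =
      fderiv ℝ g e x (s e) (t e) + g e (fderiv ℝ s e x) (t e) + g e (s e) (fderiv ℝ t e x) := by
  rw [fderiv_clm_apply (hg.clm_apply hs) ht, fderiv_clm_apply hg hs]
  simp
  ring

theorem fderiv_end_apply (hK : DifferentiableAt ℝ K e) (a x : E) :
    fderiv ℝ (fun y => K y a) e x = fderiv ℝ K e x a := by
  rw [fderiv_clm_apply hK (differentiableAt_const a)]
  simp

theorem covEnd_comp {K₁ K₂ : E → E →L[ℝ] E} (h₁ : DifferentiableAt ℝ K₁ e)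
    (h₂ : DifferentiableAt ℝ K₂ e) (h : ∀ᶠ y in 𝓝 e, K y = (K₁ y).comp (K₂ y)) (x a : E) :
    covEnd Γ K e x a = covEnd Γ K₁ e x (K₂ e a) + K₁ e (covEnd Γ K₂ e x a) := by
  have h' : K =ᶠ[𝓝 e] fun y => (K₁ y).comp (K₂ y) := h
  simp only [covEnd, h'.fderiv_eq, fderiv_clm_comp h₁ h₂, h.self_of_nhds, map_add, map_sub]
  simp
  abel

theorem covEnd_skew (hg : DifferentiableAt ℝ g e) (hK : DifferentiableAt ℝ K e)
    (hΓ : ∀ x a b, fderiv ℝ g e x a b = g e (Γ x a) b + g e a (Γ x b))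
    (hskew : ∀ᶠ y in 𝓝 e, ∀ a b, g y (K y a) b = -g y a (K y b)) (x a b : E) :
    g e (covEnd Γ K e x a) b = -g e a (covEnd Γ K e x b) := by
  have h1 : fderiv ℝ (fun y => g y (K y a) b) e x = fderiv ℝ (fun y => -g y a (K y b)) e x := by
    rw [Filter.EventuallyEq.fderiv_eq (hskew.mono fun y hy => hy a b)]
  have hKa : ∀ a, DifferentiableAt ℝ (fun y => K y a) e := fun a =>
    hK.clm_apply (differentiableAt_const a)
  have hs := hskew.self_of_nhds
  rw [fderiv_fun_neg, neg_apply, fderiv_bilin_apply hg (hKa a) (differentiableAt_const b),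
    fderiv_bilin_apply hg (differentiableAt_const a) (hKa b)] at h1
  simp only [fderiv_end_apply hK, fderiv_fun_const, Pi.zero_apply, zero_apply, map_zero,
    hΓ, hs] at h1
  simp only [covEnd, map_add, map_sub, add_apply, sub_apply, hs]
  linarith

/-- `∇K` anticommutes with `K` on the kernel of `α` and `β`, where `K` is a complex structure; in
terms of `g`, this is the covariant derivative of `hiso`. -/
theorem covEnd_isometry {α β : E → E →L[ℝ] ℝ} (hg : DifferentiableAt ℝ g e)
    (hK : DifferentiableAt ℝ K e) (hα : DifferentiableAt ℝ α e) (hβ : DifferentiableAt ℝ β e)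
    (hΓ : ∀ x a b, fderiv ℝ g e x a b = g e (Γ x a) b + g e a (Γ x b))
    (hskew : ∀ᶠ y in 𝓝 e, ∀ a b, g y (K y a) b = -g y a (K y b))
    (hiso : ∀ᶠ y in 𝓝 e, ∀ a b, g y (K y a) (K y b) = g y a b - α y a * α y b - β y a * β y b)
    (x : E) {a b : E} (ha : α e a = 0) (ha' : β e a = 0) (hb : α e b = 0) (hb' : β e b = 0) :
    g e (covEnd Γ K e x a) (K e b) = -g e (K e a) (covEnd Γ K e x b) := by
  have h1 : fderiv ℝ (fun y => g y (K y a) (K y b)) e x =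
      fderiv ℝ (fun y => g y a b - α y a * α y b - β y a * β y b) e x := by
    rw [Filter.EventuallyEq.fderiv_eq (hiso.mono fun y hy => hy a b)]
  have hKa : ∀ a, DifferentiableAt ℝ (fun y => K y a) e := fun a =>
    hK.clm_apply (differentiableAt_const a)
  have hαa : ∀ a, DifferentiableAt ℝ (fun y => α y a) e := fun a =>
    hα.clm_apply (differentiableAt_const a)
  have hβa : ∀ a, DifferentiableAt ℝ (fun y => β y a) e := fun a =>
    hβ.clm_apply (differentiableAt_const a)
  have hgab : DifferentiableAt ℝ (fun y => g y a b) e :=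
    (hg.clm_apply (differentiableAt_const a)).clm_apply (differentiableAt_const b)
  have hs := hskew.self_of_nhds
  have hi := hiso.self_of_nhds
  rw [fderiv_bilin_apply hg (hKa a) (hKa b),
    fderiv_fun_sub (hgab.fun_sub ((hαa a).fun_mul (hαa b)))
      ((hβa a).fun_mul (hβa b)),
    fderiv_fun_sub hgab ((hαa a).fun_mul (hαa b)), fderiv_fun_mul (hαa a) (hαa b),
    fderiv_fun_mul (hβa a) (hβa b), sub_apply, sub_apply,
    fderiv_bilin_apply hg (differentiableAt_const a) (differentiableAt_const b)] at h1
  simp only [fderiv_end_apply hK, fderiv_fun_const, Pi.zero_apply, zero_apply, map_zero, add_apply,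
    ha, ha', hb, hb', zero_smul, hΓ] at h1
  simp only [covEnd, map_add, map_sub, add_apply, sub_apply, hi, ha, ha', hb, hb']
  linarith

/-- The identity `d(dα) = 0` on the kernel of `α` and `β`, for a form `α` with
`dα = g(·, K·) + σ ∧ β`: there the cyclic sum of `∇K` is that of `-σ ⊗ dβ`, because `d(σ ∧ β)`
reduces to `-σ ∧ dβ`. -/
theorem covEnd_cyclic {α β σ : E → E →L[ℝ] ℝ} {K' : E →L[ℝ] E} (hg : DifferentiableAt ℝ g e)
    (hK : DifferentiableAt ℝ K e) (hα : ContDiffAt ℝ 2 α e) (hβ : DifferentiableAt ℝ β e)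
    (hσ : DifferentiableAt ℝ σ e)
    (hsymm : ∀ a b, g e a b = g e b a)
    (hΓ : ∀ x a b, fderiv ℝ g e x a b = g e (Γ x a) b + g e a (Γ x b))
    (hΓsymm : ∀ a b, Γ a b = Γ b a)
    (hskew : ∀ᶠ y in 𝓝 e, ∀ a b, g y (K y a) b = -g y a (K y b))
    (hdα : ∀ᶠ y in 𝓝 e, ∀ a b, (1 / 2 : ℝ) * (fderiv ℝ α y a b - fderiv ℝ α y b a) =
      g y a (K y b) + (1 / 2 : ℝ) * (σ y a * β y b - σ y b * β y a))
    (hdβ : ∀ a b, α e a = 0 → β e a = 0 → α e b = 0 → β e b = 0 →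
      (1 / 2 : ℝ) * (fderiv ℝ β e a b - fderiv ℝ β e b a) = g e a (K' b))
    {a b c : E} (ha : α e a = 0) (ha' : β e a = 0) (hb : α e b = 0) (hb' : β e b = 0)
    (hc : α e c = 0) (hc' : β e c = 0) :
    g e (covEnd Γ K e a b) c + g e (covEnd Γ K e b c) a + g e (covEnd Γ K e c a) b =
      -(σ e a * g e b (K' c) + σ e b * g e c (K' a) + σ e c * g e a (K' b)) := by
  have hKa : ∀ a, DifferentiableAt ℝ (fun y => K y a) e := fun a =>
    hK.clm_apply (differentiableAt_const a)
  have hαd : DifferentiableAt ℝ (fderiv ℝ α) e :=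
    (hα.fderiv_right (m := 1) (by norm_num)).differentiableAt (by norm_num)
  have hsym2 : ∀ a b, fderiv ℝ (fderiv ℝ α) e a b = fderiv ℝ (fderiv ℝ α) e b a := by
    intro a b
    exact (hα.isSymmSndFDerivAt (by simp)) a b
  have hβa : ∀ a, DifferentiableAt ℝ (fun y => β y a) e := fun a =>
    hβ.clm_apply (differentiableAt_const a)
  have hσa : ∀ a, DifferentiableAt ℝ (fun y => σ y a) e := fun a =>
    hσ.clm_apply (differentiableAt_const a)
  have hαab : ∀ a b, DifferentiableAt ℝ (fun y => fderiv ℝ α y a b) e := fun a b =>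
    (hαd.clm_apply (differentiableAt_const a)).clm_apply (differentiableAt_const b)
  have hd2 : ∀ a b x, fderiv ℝ (fun y => fderiv ℝ α y a b) e x =
      fderiv ℝ (fderiv ℝ α) e x a b := by
    intro a b x
    rw [fderiv_clm_apply (hαd.clm_apply (differentiableAt_const a)) (differentiableAt_const b),
      fderiv_clm_apply hαd (differentiableAt_const a)]
    simp
  have hdβa : ∀ a x, fderiv ℝ (fun y => β y a) e x = fderiv ℝ β e x a := by
    intro a x
    rw [fderiv_clm_apply hβ (differentiableAt_const a)]; simp
  have hs := hskew.self_of_nhds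
  have key : ∀ a b x, β e a = 0 → β e b = 0 →
      (1 / 2 : ℝ) * (fderiv ℝ (fderiv ℝ α) e x a b - fderiv ℝ (fderiv ℝ α) e x b a) =
      g e (Γ x a) (K e b) + g e a (covEnd Γ K e x b) + g e a (K e (Γ x b))
      + (1 / 2 : ℝ) * (σ e a * fderiv ℝ β e x b - σ e b * fderiv ℝ β e x a) := by
    intro a b x ha hb
    have h1 : fderiv ℝ (fun y => (1 / 2 : ℝ) * (fderiv ℝ α y a b - fderiv ℝ α y b a)) e x =
        fderiv ℝ (fun y => g y a (K y b) + (1 / 2 : ℝ) * (σ y a * β y b - σ y b * β y a)) e x := by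
      rw [Filter.EventuallyEq.fderiv_eq (hdα.mono fun y hy => hy a b)]
    have hm : ∀ a b, DifferentiableAt ℝ (fun y => σ y a * β y b) e := fun a b =>
      (hσa a).fun_mul (hβa b)
    rw [fderiv_const_mul ((hαab a b).fun_sub (hαab b a)), fderiv_fun_sub (hαab a b) (hαab b a),
      fderiv_fun_add ((hg.clm_apply (differentiableAt_const a)).clm_apply (hKa b))
        (((hm a b).fun_sub (hm b a)).const_mul _), fderiv_const_mul ((hm a b).fun_sub (hm b a)),
      fderiv_fun_sub (hm a b) (hm b a), fderiv_fun_mul (hσa a) (hβa b),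
      fderiv_fun_mul (hσa b) (hβa a), add_apply,
      fderiv_bilin_apply hg (differentiableAt_const a) (hKa b)] at h1
    simp only [smul_apply, sub_apply, add_apply, hd2, hdβa, ha, hb, zero_smul, smul_eq_mul,
      fderiv_end_apply hK, fderiv_fun_const, Pi.zero_apply, zero_apply, map_zero, hΓ] at h1
    simp only [covEnd, map_add, map_sub]
    linarith
  have k1 := key a b c ha' hb'
  have k2 := key b c a hb' hc'
  have k3 := key c a b hc' ha'
  have s1 := DFunLike.congr_fun (hsym2 a b) c
  have s2 := DFunLike.congr_fun (hsym2 b c) a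
  have s3 := DFunLike.congr_fun (hsym2 c a) b
  have t1 : ∀ a b c, g e a (K e (Γ c b)) = - g e (Γ b c) (K e a) := fun a b c => by
    rw [hΓsymm c b, hsymm a, hs]
  rw [t1] at k1 k2 k3
  rw [hsymm (covEnd Γ K e a b), hsymm (covEnd Γ K e b c), hsymm (covEnd Γ K e c a),
    ← hdβ b c hb hb' hc hc', ← hdβ c a hc hc' ha ha', ← hdβ a b ha ha' hb hb']
  have u1 := covEnd_skew hg hK hΓ hskew a b c
  have u2 := covEnd_skew hg hK hΓ hskew b c a
  have u3 := covEnd_skew hg hK hΓ hskew c a b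
  rw [hsymm] at u1 u2 u3
  linarith

/-- In the Nijenhuis tensor of `K`, partial derivatives may be replaced by the covariant derivatives
of a torsion-free connection. -/
theorem covEnd_nijenhuis (hΓsymm : ∀ a b, Γ a b = Γ b a) (a b : E) :
    covEnd Γ K e (K e a) b - covEnd Γ K e (K e b) a - K e (covEnd Γ K e a b)
        + K e (covEnd Γ K e b a) =
      fderiv ℝ K e (K e a) b - fderiv ℝ K e (K e b) a - K e (fderiv ℝ K e a b)
        + K e (fderiv ℝ K e b a) := by
  simp only [covEnd, map_add, map_sub]
  rw [hΓsymm b (K e a), hΓsymm (K e b) a, hΓsymm b a, hΓsymm (K e a) (K e b)]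
  abel

/-- A coordinate form of `∇K = σ ⊗ K'` on the kernel of `α` and `β`, for a metric `g` with
Levi-Civita connection `Γ`, from the structure equations for `dα` and `dβ` and the vanishing `hN` of
the Nijenhuis tensor up to terms with `σ`. -/
theorem inner_covEnd_eq {α β σ : E → E →L[ℝ] ℝ} {K' : E →L[ℝ] E} (hg : DifferentiableAt ℝ g e)
    (hK : DifferentiableAt ℝ K e) (hα : ContDiffAt ℝ 2 α e) (hβ : DifferentiableAt ℝ β e)
    (hσ : DifferentiableAt ℝ σ e)
    (hsymm : ∀ a b, g e a b = g e b a)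
    (hΓ : ∀ x a b, fderiv ℝ g e x a b = g e (Γ x a) b + g e a (Γ x b))
    (hΓsymm : ∀ a b, Γ a b = Γ b a)
    (hskew : ∀ᶠ y in 𝓝 e, ∀ a b, g y (K y a) b = -g y a (K y b))
    (hiso : ∀ᶠ y in 𝓝 e, ∀ a b, g y (K y a) (K y b) = g y a b - α y a * α y b - β y a * β y b)
    (hdα : ∀ᶠ y in 𝓝 e, ∀ a b, (1 / 2 : ℝ) * (fderiv ℝ α y a b - fderiv ℝ α y b a) =
      g y a (K y b) + (1 / 2 : ℝ) * (σ y a * β y b - σ y b * β y a))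
    (hdβ : ∀ a b, α e a = 0 → β e a = 0 → α e b = 0 → β e b = 0 →
      (1 / 2 : ℝ) * (fderiv ℝ β e a b - fderiv ℝ β e b a) = g e a (K' b))
    (hskew' : ∀ a b, g e (K' a) b = -g e a (K' b))
    (hKh : ∀ a, α e a = 0 → β e a = 0 → α e (K e a) = 0 ∧ β e (K e a) = 0)
    (hKK : ∀ a, α e a = 0 → β e a = 0 → K e (K e a) = -a)
    (hanti : ∀ a, α e a = 0 → β e a = 0 → K' (K e a) = -K e (K' a))
    (hN : ∀ a b w, α e a = 0 → β e a = 0 → α e b = 0 → β e b = 0 → α e w = 0 → β e w = 0 →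
      g e w (fderiv ℝ K e (K e a) b - fderiv ℝ K e (K e b) a - K e (fderiv ℝ K e a b)
        + K e (fderiv ℝ K e b a) + σ e (K e b) • K' a - σ e (K e a) • K' b
        + σ e a • K e (K' b) - σ e b • K e (K' a)) = 0)
    {a b c : E} (ha : α e a = 0) (ha' : β e a = 0) (hb : α e b = 0) (hb' : β e b = 0)
    (hc : α e c = 0) (hc' : β e c = 0) :
    g e (covEnd Γ K e a b) c = σ e a * g e (K' b) c := by
  let h : Submodule ℝ E := (α e).toLinearMap.ker ⊓ (β e).toLinearMap.ker
  have hh : ∀ {a}, a ∈ h → α e a = 0 ∧ β e a = 0 := fun ha => ha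
  refine covariant_formula_of_nijenhuis (h := h) (A := covEnd Γ K e) (K := K e) hsymm
    (fun a ha => hKh a (hh ha).1 (hh ha).2) (fun a ha => hKK a (hh ha).1 (hh ha).2)
    hskew.self_of_nhds hskew' (fun a ha => hanti a (hh ha).1 (hh ha).2)
    (fun x a _ b _ => covEnd_skew hg hK hΓ hskew x a b)
    (fun x a ha b hb => covEnd_isometry hg hK (hα.differentiableAt (by norm_num)) hβ hΓ hskew hiso x
      (hh ha).1 (hh ha).2 (hh hb).1 (hh hb).2)
    (fun a ha b hb c hc => covEnd_cyclic hg hK hα hβ hσ hsymm hΓ hΓsymm hskew hdα hdβ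
      (hh ha).1 (hh ha).2 (hh hb).1 (hh hb).2 (hh hc).1 (hh hc).2)
    (fun a ha b hb w hw => ?_) (a := a) (b := b) (c := c) ⟨ha, ha'⟩ ⟨hb, hb'⟩ ⟨hc, hc'⟩
  rw [covEnd_nijenhuis hΓsymm]
  exact hN a b w (hh ha).1 (hh ha).2 (hh hb).1 (hh hb).2 (hh hw).1 (hh hw).2

end Coordinates

/-! ### Tensor fields in a chart -/

section Chart

variable {E : Type*} [NormedAddCommGroup E] [NormedSpace ℝ E]
  {P : Type*} [TopologicalSpace P] [ChartedSpace E P]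

variable (E) in
/-- The derivative at `y` of the chart at `p`. -/
noncomputable def chartD (p y : P) : E →L[ℝ] E :=
  mfderiv 𝓘(ℝ, E) 𝓘(ℝ, E) (extChartAt 𝓘(ℝ, E) p) y

/-- The derivative at `e` of the inverse of the chart at `p`. -/
noncomputable def chartInvD (p : P) (e : E) : E →L[ℝ] E :=
  mfderiv 𝓘(ℝ, E) 𝓘(ℝ, E) (extChartAt 𝓘(ℝ, E) p).symm e

/-- The coordinate field with constant coefficients `a` in the chart at `p`. -/
noncomputable def frame (p : P) (a : E) (y : P) : TangentSpace 𝓘(ℝ, E) y :=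
  chartInvD p (extChartAt 𝓘(ℝ, E) p y) a

/-- A one-form read in the chart at `p`. -/
noncomputable def formCoord (α : Π y : P, TangentSpace 𝓘(ℝ, E) y →L[ℝ] ℝ) (p : P) (e : E) :
    E →L[ℝ] ℝ :=
  ContinuousLinearMap.comp (α ((extChartAt 𝓘(ℝ, E) p).symm e) : E →L[ℝ] ℝ) (chartInvD p e)

/-- A `(1,1)`-tensor field read in the chart at `p`. -/
noncomputable def endCoord (A : Π y : P, TangentSpace 𝓘(ℝ, E) y →L[ℝ] TangentSpace 𝓘(ℝ, E) y)
    (p : P) (e : E) : E →L[ℝ] E :=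
  (chartD E p ((extChartAt 𝓘(ℝ, E) p).symm e)).comp
    (ContinuousLinearMap.comp (A ((extChartAt 𝓘(ℝ, E) p).symm e) : E →L[ℝ] E) (chartInvD p e))

/-- A vector field read in the chart at `p`. -/
noncomputable def fieldCoord (X : Π y : P, TangentSpace 𝓘(ℝ, E) y) (p : P) (e : E) : E :=
  chartD E p ((extChartAt 𝓘(ℝ, E) p).symm e) (X ((extChartAt 𝓘(ℝ, E) p).symm e))

/-- The constant vector field `a` on a vector space. -/
def constField (a e : E) : TangentSpace 𝓘(ℝ, E) e := a

variable {p : P}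

theorem source_mem_nhds' {y : P} (hy : y ∈ (extChartAt 𝓘(ℝ, E) p).source) :
    (extChartAt 𝓘(ℝ, E) p).source ∈ 𝓝 y :=
  (isOpen_extChartAt_source p).mem_nhds hy

theorem formCoord_extChartAt (α : Π y : P, TangentSpace 𝓘(ℝ, E) y →L[ℝ] ℝ) {y : P}
    (hy : y ∈ (extChartAt 𝓘(ℝ, E) p).source) (a : E) :
    formCoord α p (extChartAt 𝓘(ℝ, E) p y) a = α y (frame p a y) := by
  have : ∀ z, z = y → ∀ v : E, (α z : E →L[ℝ] ℝ) v = (α y : E →L[ℝ] ℝ) v := by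
    rintro z rfl v; rfl
  exact this _ ((extChartAt 𝓘(ℝ, E) p).left_inv hy) _

theorem endCoord_extChartAt
    (A : Π y : P, TangentSpace 𝓘(ℝ, E) y →L[ℝ] TangentSpace 𝓘(ℝ, E) y) {y : P}
    (hy : y ∈ (extChartAt 𝓘(ℝ, E) p).source) (a : E) :
    endCoord A p (extChartAt 𝓘(ℝ, E) p y) a = chartD E p y (A y (frame p a y)) := by
  have : ∀ z, z = y → ∀ v : E, chartD E p z ((A z : E →L[ℝ] E) v) =
      chartD E p y ((A y : E →L[ℝ] E) v) := by
    rintro z rfl v; rfl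
  exact this _ ((extChartAt 𝓘(ℝ, E) p).left_inv hy) _

theorem fieldCoord_extChartAt (X : Π y : P, TangentSpace 𝓘(ℝ, E) y) {y : P}
    (hy : y ∈ (extChartAt 𝓘(ℝ, E) p).source) :
    fieldCoord X p (extChartAt 𝓘(ℝ, E) p y) = chartD E p y (X y) := by
  have : ∀ z, z = y → chartD E p z (X z) = chartD E p y (X y) := by
    rintro z rfl; rfl
  exact this _ ((extChartAt 𝓘(ℝ, E) p).left_inv hy)

variable [IsManifold 𝓘(ℝ, E) ∞ P]

theorem chartD_chartInvD' {y : P} (hy : y ∈ (extChartAt 𝓘(ℝ, E) p).source) (a : E) :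
    chartD E p y (chartInvD p (extChartAt 𝓘(ℝ, E) p y) a) = a := by
  have := mfderiv_extChartAt_comp_mfderivWithin_extChartAt_symm' (I := 𝓘(ℝ, E)) hy
  simp only [modelWithCornersSelf_coe, range_id, mfderivWithin_univ] at this
  exact DFunLike.congr_fun this a

theorem chartInvD_chartD {y : P} (hy : y ∈ (extChartAt 𝓘(ℝ, E) p).source) (a : E) :
    chartInvD p (extChartAt 𝓘(ℝ, E) p y) (chartD E p y a) = a := by
  have := mfderivWithin_extChartAt_symm_comp_mfderiv_extChartAt' (I := 𝓘(ℝ, E)) hy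
  simp only [modelWithCornersSelf_coe, range_id, mfderivWithin_univ] at this
  exact DFunLike.congr_fun this a

theorem chartInvD_chartD' {e : E} (he : e ∈ (extChartAt 𝓘(ℝ, E) p).target) (a : E) :
    chartInvD p e (chartD E p ((extChartAt 𝓘(ℝ, E) p).symm e) a) = a := by
  have := mfderivWithin_extChartAt_symm_comp_mfderiv_extChartAt (I := 𝓘(ℝ, E)) he
  simp only [modelWithCornersSelf_coe, range_id, mfderivWithin_univ] at this
  exact DFunLike.congr_fun this a

theorem chartD_self (p : P) : chartD E p p = ContinuousLinearMap.id ℝ E :=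
  mfderiv_extChartAt_self (I := 𝓘(ℝ, E))

theorem chartInvD_self (p : P) :
    chartInvD p (extChartAt 𝓘(ℝ, E) p p) = ContinuousLinearMap.id ℝ E := by
  ext a
  have := chartInvD_chartD (mem_extChartAt_source (I := 𝓘(ℝ, E)) p) a
  rwa [chartD_self] at this

theorem frame_self (p : P) (a : E) : frame p a p = a := by
  simp only [frame, chartInvD_self]; rfl

theorem frame_eq_mpullback {y : P} (hy : y ∈ (extChartAt 𝓘(ℝ, E) p).source) (a : E) :
    frame p a y = mpullback 𝓘(ℝ, E) 𝓘(ℝ, E) (extChartAt 𝓘(ℝ, E) p) (constField a) y := by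
  obtain ⟨L, hL⟩ := isInvertible_mfderiv_extChartAt (I := 𝓘(ℝ, E)) hy
  rw [mpullback_apply, ← hL, ContinuousLinearMap.inverse_equiv]
  apply L.injective
  have h2 := chartD_chartInvD' hy a
  have h3 : ∀ v : E, chartD E p y v = L v := fun v => (DFunLike.congr_fun hL v).symm
  rw [h3] at h2
  exact h2.trans (L.apply_symm_apply a).symm

theorem contMDiffAt_const_field (a : E) (e : E) :
    ContMDiffAt 𝓘(ℝ, E) 𝓘(ℝ, E).tangent ∞
      (fun z => (⟨z, constField a z⟩ : TangentBundle 𝓘(ℝ, E) E)) e := by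
  exact contMDiffAt_vectorSpace_iff_contDiffAt.2 (contDiffAt_const (c := a))

theorem contMDiffAt_frame {y : P} (hy : y ∈ (extChartAt 𝓘(ℝ, E) p).source) [CompleteSpace E]
    (a : E) :
    ContMDiffAt 𝓘(ℝ, E) 𝓘(ℝ, E).tangent ∞
      (fun z => (⟨z, frame p a z⟩ : TangentBundle 𝓘(ℝ, E) P)) y := by
  have h1 := ContMDiffAt.mpullback_vectorField_preimage (n := ∞) (m := ∞)
    (contMDiffAt_const_field a (extChartAt 𝓘(ℝ, E) p y))
    (contMDiffAt_extChartAt' (I := 𝓘(ℝ, E)) (x := p) (by simpa using hy))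
    (isInvertible_mfderiv_extChartAt (I := 𝓘(ℝ, E)) hy) (by simp)
  refine h1.congr_of_eventuallyEq ?_
  filter_upwards [source_mem_nhds' hy] with z hz
  rw [frame_eq_mpullback hz a]

theorem smoothNear_frame {y : P} (hy : y ∈ (extChartAt 𝓘(ℝ, E) p).source) [CompleteSpace E]
    (a : E) : SmoothNear (frame p a) y := by
  filter_upwards [source_mem_nhds' hy] with z hz
  exact contMDiffAt_frame hz a

theorem mlieBracket_frame {y : P} (hy : y ∈ (extChartAt 𝓘(ℝ, E) p).source) [CompleteSpace E]
    (a b : E) : mlieBracket 𝓘(ℝ, E) (frame p a) (frame p b) y = 0 := by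
  have : IsManifold 𝓘(ℝ, E) (minSmoothness ℝ 2) P := by
    rw [minSmoothness_of_isRCLikeNormedField]; infer_instance
  have e : ∀ a : E, frame p a =ᶠ[𝓝 y]
      mpullback 𝓘(ℝ, E) 𝓘(ℝ, E) (extChartAt 𝓘(ℝ, E) p) (constField a) := by
    intro a
    filter_upwards [source_mem_nhds' hy] with z hz
    exact frame_eq_mpullback hz a
  rw [(e a).mlieBracket_vectorField_eq (e b), ← mpullback_mlieBracket (n := ∞)
    ((contMDiffAt_const_field a _).mdifferentiableAt (by simp))
    ((contMDiffAt_const_field b _).mdifferentiableAt (by simp))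
    (contMDiffAt_extChartAt' (I := 𝓘(ℝ, E)) (x := p) (by simpa using hy))
    (by rw [minSmoothness_of_isRCLikeNormedField]
        exact WithTop.coe_le_coe.2 (le_top : (2 : ℕ∞) ≤ ⊤))]
  rw [mpullback_apply, ← mlieBracketWithin_univ, mlieBracketWithin_eq_lieBracketWithin]
  have : lieBracketWithin ℝ (constField a : E → E) (constField b) univ
      (extChartAt 𝓘(ℝ, E) p y) = 0 := by
    change lieBracketWithin ℝ (fun _ : E => a) (fun _ => b) _ _ = 0
    simp [lieBracketWithin]
  exact (congrArg _ this).trans (map_zero _)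

omit [IsManifold 𝓘(ℝ, E) ∞ P] in
/-- The coordinate expression at `p` of a function on `P` that is `C^n` at `p`. -/
theorem contDiffAt_comp_symm {F : Type*} [NormedAddCommGroup F] [NormedSpace ℝ F] {n : WithTop ℕ∞}
    [IsManifold 𝓘(ℝ, E) n P]
    {k : P → F} (hk : ContMDiffAt 𝓘(ℝ, E) 𝓘(ℝ, F) n k p) :
    ContDiffAt ℝ n (fun e => k ((extChartAt 𝓘(ℝ, E) p).symm e)) (extChartAt 𝓘(ℝ, E) p p) := by
  rw [← contMDiffAt_iff_contDiffAt]
  have h1 : ContMDiffAt 𝓘(ℝ, E) 𝓘(ℝ, E) n (extChartAt 𝓘(ℝ, E) p).symm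
      (extChartAt 𝓘(ℝ, E) p p) :=
    (contMDiffOn_extChartAt_symm p).contMDiffAt (extChartAt_target_mem_nhds p)
  exact ContMDiffAt.comp_of_eq hk h1 (extChartAt_to_inv p)

theorem contDiffAt_of_contMDiffAt_comp {F : Type*} [NormedAddCommGroup F] [NormedSpace ℝ F]
    {k : P → F} {k' : E → F} (hk : ContMDiffAt 𝓘(ℝ, E) 𝓘(ℝ, F) ∞ k p)
    (h : ∀ᶠ y in 𝓝 p, k y = k' (extChartAt 𝓘(ℝ, E) p y)) :
    ContDiffAt ℝ ∞ k' (extChartAt 𝓘(ℝ, E) p p) := by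
  refine (contDiffAt_comp_symm hk).congr_of_eventuallyEq ?_
  have h1 : Tendsto (extChartAt 𝓘(ℝ, E) p).symm (𝓝 (extChartAt 𝓘(ℝ, E) p p)) (𝓝 p) := by
    have := continuousAt_extChartAt_symm (I := 𝓘(ℝ, E)) p
    rwa [ContinuousAt, extChartAt_to_inv p] at this
  filter_upwards [h1.eventually h, extChartAt_target_mem_nhds (I := 𝓘(ℝ, E)) p] with e he he'
  rw [he, (extChartAt 𝓘(ℝ, E) p).right_inv he']

theorem continuousLinearMapAt_eq_chartD {y : P} (hy : y ∈ (extChartAt 𝓘(ℝ, E) p).source) :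
    (trivializationAt E (TangentSpace 𝓘(ℝ, E)) p).continuousLinearMapAt ℝ y = chartD E p y :=
  TangentBundle.continuousLinearMapAt_trivializationAt (by simpa using hy)

theorem symmL_eq_chartInvD {y : P} (hy : y ∈ (extChartAt 𝓘(ℝ, E) p).source) :
    (trivializationAt E (TangentSpace 𝓘(ℝ, E)) p).symmL ℝ y =
      chartInvD p (extChartAt 𝓘(ℝ, E) p y) := by
  have := TangentBundle.symmL_trivializationAt (I := 𝓘(ℝ, E)) (x₀ := p) (x := y)
    (by simpa using hy)
  simp only [modelWithCornersSelf_coe, range_id, mfderivWithin_univ] at this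
  exact this

theorem contDiffAt_formCoord {α : Π y : P, TangentSpace 𝓘(ℝ, E) y →L[ℝ] ℝ} {s : Set P}
    (hα : SmoothFormOn α s) (hs : s ∈ 𝓝 p) :
    ContDiffAt ℝ ∞ (formCoord α p) (extChartAt 𝓘(ℝ, E) p p) := by
  have h := ((contMDiffAt_hom_bundle (F₁ := E) (F₂ := ℝ)
    (E₁ := fun y : P => TangentSpace 𝓘(ℝ, E) y) (E₂ := Trivial P ℝ) _).1
    (ContMDiffOn.contMDiffAt hα hs)).2
  refine contDiffAt_of_contMDiffAt_comp (E := E) h ?_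
  filter_upwards [source_mem_nhds' (mem_extChartAt_source (I := 𝓘(ℝ, E)) p)] with y hy
  ext a
  rw [formCoord_extChartAt α hy]
  refine Eq.trans ?_ (congrArg (α y) (DFunLike.congr_fun (symmL_eq_chartInvD hy) a))
  simp [ContinuousLinearMap.inCoordinates]

theorem contDiffAt_endCoord
    {A : Π y : P, TangentSpace 𝓘(ℝ, E) y →L[ℝ] TangentSpace 𝓘(ℝ, E) y} {s : Set P}
    (hA : SmoothEndOn A s) (hs : s ∈ 𝓝 p) :
    ContDiffAt ℝ ∞ (endCoord A p) (extChartAt 𝓘(ℝ, E) p p) := by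
  have h := ((contMDiffAt_hom_bundle (F₁ := E) (F₂ := E)
    (E₁ := fun y : P => TangentSpace 𝓘(ℝ, E) y) (E₂ := fun y : P => TangentSpace 𝓘(ℝ, E) y) _).1
    (ContMDiffOn.contMDiffAt hA hs)).2
  refine contDiffAt_of_contMDiffAt_comp (E := E) h ?_
  filter_upwards [source_mem_nhds' (mem_extChartAt_source (I := 𝓘(ℝ, E)) p)] with y hy
  ext a
  rw [endCoord_extChartAt A hy]
  have h1 := DFunLike.congr_fun (symmL_eq_chartInvD hy) a
  have h2 := DFunLike.congr_fun (continuousLinearMapAt_eq_chartD hy)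
  exact (h2 _).trans (congrArg (fun v => chartD E p y (A y v)) h1)

end Chart

/-! ### Derivatives in a chart -/

section Chart

variable {E : Type*} [NormedAddCommGroup E] [NormedSpace ℝ E]
  {P : Type*} [TopologicalSpace P] [ChartedSpace E P] {p : P} [IsManifold 𝓘(ℝ, E) ∞ P]

theorem contMDiffAt_form_apply {α : Π y : P, TangentSpace 𝓘(ℝ, E) y →L[ℝ] ℝ} {s : Set P}
    (hα : SmoothFormOn α s) {X : Π y : P, TangentSpace 𝓘(ℝ, E) y} {y : P} (hs : s ∈ 𝓝 y)
    (hX : ContMDiffAt 𝓘(ℝ, E) 𝓘(ℝ, E).tangent ∞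
      (fun z => (⟨z, X z⟩ : TangentBundle 𝓘(ℝ, E) P)) y) :
    ContMDiffAt 𝓘(ℝ, E) 𝓘(ℝ, ℝ) ∞ (fun z => α z (X z)) y := by
  have h : ContMDiffAt 𝓘(ℝ, E) (𝓘(ℝ, E).prod 𝓘(ℝ, ℝ)) ∞
      (fun z => TotalSpace.mk' ℝ (E := Trivial P ℝ) z (α z (X z))) y :=
    ContMDiffAt.clm_bundle_apply (E₁ := fun y : P => TangentSpace 𝓘(ℝ, E) y)
      (E₂ := Trivial P ℝ) (ContMDiffOn.contMDiffAt hα hs) hX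
  exact (contMDiffAt_totalSpace.1 h).2

/-- The coordinate expression of a smooth vector field along a map. -/
theorem contMDiffAt_chartD_apply {F : Type*} [NormedAddCommGroup F] [NormedSpace ℝ F]
    {M : Type*} [TopologicalSpace M] [ChartedSpace F M] {f : M → P}
    {s : Π x : M, TangentSpace 𝓘(ℝ, E) (f x)} {x : M}
    (hs : ContMDiffAt 𝓘(ℝ, F) 𝓘(ℝ, E).tangent ∞
      (fun y => (⟨f y, s y⟩ : TangentBundle 𝓘(ℝ, E) P)) x) :
    ContMDiffAt 𝓘(ℝ, F) 𝓘(ℝ, E) ∞ (fun y => chartD E (f x) (f y) (s y)) x := by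
  have h := contMDiffAt_totalSpace.1 hs
  refine h.2.congr_of_eventuallyEq ?_
  filter_upwards [h.1.continuousAt.preimage_mem_nhds
    (source_mem_nhds' (mem_extChartAt_source (I := 𝓘(ℝ, E)) (f x)))] with y hy
  have h1 := DFunLike.congr_fun (continuousLinearMapAt_eq_chartD (E := E) (p := f x) hy) (s y)
  refine h1.symm.trans ?_
  rw [Trivialization.continuousLinearMapAt_apply, Trivialization.linearMapAt_apply, if_pos]
  simpa using hy

theorem contDiffAt_fieldCoord {X : Π y : P, TangentSpace 𝓘(ℝ, E) y}
    (hX : ContMDiffAt 𝓘(ℝ, E) 𝓘(ℝ, E).tangent ∞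
      (fun z => (⟨z, X z⟩ : TangentBundle 𝓘(ℝ, E) P)) p) :
    ContDiffAt ℝ ∞ (fieldCoord X p) (extChartAt 𝓘(ℝ, E) p p) := by
  refine contDiffAt_of_contMDiffAt_comp (E := E) (contMDiffAt_chartD_apply (f := id) hX) ?_
  filter_upwards [source_mem_nhds' (mem_extChartAt_source (I := 𝓘(ℝ, E)) p)] with y hy
  rw [fieldCoord_extChartAt X hy]; rfl

theorem fieldCoord_self (X : Π y : P, TangentSpace 𝓘(ℝ, E) y) :
    fieldCoord X p (extChartAt 𝓘(ℝ, E) p p) = X p := by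
  rw [fieldCoord_extChartAt X (mem_extChartAt_source p), chartD_self]; rfl

theorem formCoord_self (α : Π y : P, TangentSpace 𝓘(ℝ, E) y →L[ℝ] ℝ) (a : E) :
    formCoord α p (extChartAt 𝓘(ℝ, E) p p) a = α p a := by
  rw [formCoord_extChartAt α (mem_extChartAt_source p), frame_self]

theorem endCoord_self (A : Π y : P, TangentSpace 𝓘(ℝ, E) y →L[ℝ] TangentSpace 𝓘(ℝ, E) y) (a : E) :
    endCoord A p (extChartAt 𝓘(ℝ, E) p p) a = A p a := by
  rw [endCoord_extChartAt A (mem_extChartAt_source p), frame_self, chartD_self]; rfl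

theorem frame_endCoord {A : Π y : P, TangentSpace 𝓘(ℝ, E) y →L[ℝ] TangentSpace 𝓘(ℝ, E) y} {y : P}
    (hy : y ∈ (extChartAt 𝓘(ℝ, E) p).source) (a : E) :
    frame p (endCoord A p (extChartAt 𝓘(ℝ, E) p y) a) y = A y (frame p a y) := by
  rw [endCoord_extChartAt A hy]
  exact chartInvD_chartD hy _

omit [IsManifold 𝓘(ℝ, E) ∞ P] in
/-- A property that holds near `p` holds for the coordinate points near the image of `p`. -/
theorem eventually_extChartAt {Q : E → Prop} (h : ∀ᶠ y in 𝓝 p, Q (extChartAt 𝓘(ℝ, E) p y)) :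
    ∀ᶠ e in 𝓝 (extChartAt 𝓘(ℝ, E) p p), Q e := by
  have h1 : Tendsto (extChartAt 𝓘(ℝ, E) p).symm (𝓝 (extChartAt 𝓘(ℝ, E) p p)) (𝓝 p) := by
    have := continuousAt_extChartAt_symm (I := 𝓘(ℝ, E)) p
    rwa [ContinuousAt, extChartAt_to_inv p] at this
  filter_upwards [h1.eventually h, extChartAt_target_mem_nhds (I := 𝓘(ℝ, E)) p] with e he he'
  rwa [(extChartAt 𝓘(ℝ, E) p).right_inv he'] at he

/-- The derivative of a function with coordinate expression `k'`. -/
theorem mvfderiv_comp_chart {A : Type*} [NormedAddCommGroup A] [NormedSpace ℝ A]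
    {y : P} (hy : y ∈ (extChartAt 𝓘(ℝ, E) p).source) {k : P → A} {k' : E → A}
    (hk : DifferentiableAt ℝ k' (extChartAt 𝓘(ℝ, E) p y))
    (h : ∀ᶠ z in 𝓝 y, k z = k' (extChartAt 𝓘(ℝ, E) p z)) (v : TangentSpace 𝓘(ℝ, E) y) :
    mvfderiv 𝓘(ℝ, E) k y v = fderiv ℝ k' (extChartAt 𝓘(ℝ, E) p y) (chartD E p y v) := by
  have h1 : HasMFDerivAt 𝓘(ℝ, E) 𝓘(ℝ, E) (extChartAt 𝓘(ℝ, E) p) y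
      (mfderiv 𝓘(ℝ, E) 𝓘(ℝ, E) (extChartAt 𝓘(ℝ, E) p) y) :=
    (mdifferentiableAt_extChartAt (by simpa using hy)).hasMFDerivAt
  have h2 := (hk.hasFDerivAt.hasMFDerivAt.comp y h1).congr_of_eventuallyEq h
  rw [mvfderiv, h2.mfderiv]
  rfl

theorem extDerivForm_frame [CompleteSpace E] {α : Π y : P, TangentSpace 𝓘(ℝ, E) y →L[ℝ] ℝ} {y : P}
    (hy : y ∈ (extChartAt 𝓘(ℝ, E) p).source)
    (hα : DifferentiableAt ℝ (formCoord α p) (extChartAt 𝓘(ℝ, E) p y)) (a b : E) :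
    extDerivForm α (frame p a) (frame p b) y =
      (1 / 2 : ℝ) * (fderiv ℝ (formCoord α p) (extChartAt 𝓘(ℝ, E) p y) a b
        - fderiv ℝ (formCoord α p) (extChartAt 𝓘(ℝ, E) p y) b a) := by
  have key : ∀ a b : E, mvfderiv 𝓘(ℝ, E) (fun z => α z (frame p b z)) y (frame p a y) =
      fderiv ℝ (formCoord α p) (extChartAt 𝓘(ℝ, E) p y) a b := by
    intro a b
    rw [mvfderiv_comp_chart (k' := fun e => formCoord α p e b) hy
      (hα.clm_apply (differentiableAt_const b))]
    · rw [fderiv_clm_apply hα (differentiableAt_const b)]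
      have : chartD E p y (frame p a y) = a := chartD_chartInvD' hy a
      rw [this]; simp
    · filter_upwards [source_mem_nhds' hy] with z hz
      rw [formCoord_extChartAt α hz]
  rw [extDerivForm, key, key, mlieBracket_frame hy, map_zero, sub_zero, smul_eq_mul]

/-- The Lie bracket at `p` in the chart at `p`, whose derivative at `p` is the identity. -/
theorem mlieBracket_eq_fderiv {X Y : Π y : P, TangentSpace 𝓘(ℝ, E) y} {x y : E} (hx : X p = x)
    (hy : Y p = y) :
    mlieBracket 𝓘(ℝ, E) X Y p =
      fderiv ℝ (fieldCoord Y p) (extChartAt 𝓘(ℝ, E) p p) x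
        - fderiv ℝ (fieldCoord X p) (extChartAt 𝓘(ℝ, E) p p) y := by
  have h : ∀ X : Π y : P, TangentSpace 𝓘(ℝ, E) y,
      (mpullbackWithin 𝓘(ℝ, E) 𝓘(ℝ, E) (extChartAt 𝓘(ℝ, E) p).symm X
        (range 𝓘(ℝ, E)) : E → E) =ᶠ[𝓝 (extChartAt 𝓘(ℝ, E) p p)] fieldCoord X p := by
    intro X
    filter_upwards [extChartAt_target_mem_nhds (I := 𝓘(ℝ, E)) p] with e he
    obtain ⟨L, hL⟩ := isInvertible_mfderivWithin_extChartAt_symm (I := 𝓘(ℝ, E)) he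
    rw [mpullbackWithin_apply, ← hL, ContinuousLinearMap.inverse_equiv]
    simp only [modelWithCornersSelf_coe, range_id, mfderivWithin_univ] at hL
    apply L.injective
    have h3 : ∀ v : E, chartInvD p e v = L v := fun v => (DFunLike.congr_fun hL v).symm
    refine (L.apply_symm_apply _).trans ?_
    rw [← h3]
    exact (chartInvD_chartD' he _).symm
  rw [← mlieBracketWithin_univ, mlieBracketWithin_apply]
  have h1 : (mfderiv 𝓘(ℝ, E) 𝓘(ℝ, E) (extChartAt 𝓘(ℝ, E) p) p).inverse =
      ContinuousLinearMap.id ℝ E := by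
    rw [mfderiv_extChartAt_self]; exact ContinuousLinearMap.inverse_id
  rw [h1]
  have h2 : lieBracket ℝ (mpullbackWithin 𝓘(ℝ, E) 𝓘(ℝ, E) (extChartAt 𝓘(ℝ, E) p).symm X
        (range 𝓘(ℝ, E)) : E → E) (mpullbackWithin 𝓘(ℝ, E) 𝓘(ℝ, E) (extChartAt 𝓘(ℝ, E) p).symm Y
        (range 𝓘(ℝ, E)) : E → E) (extChartAt 𝓘(ℝ, E) p p) =
      fderiv ℝ (fieldCoord Y p) (extChartAt 𝓘(ℝ, E) p p) x
        - fderiv ℝ (fieldCoord X p) (extChartAt 𝓘(ℝ, E) p p) y := by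
    rw [(h X).lieBracket_vectorField_eq (h Y), lieBracket, fieldCoord_self, fieldCoord_self, hx, hy]
  have h3 : ∀ (V W : E → E) (s : Set E), s = univ → ∀ e,
      lieBracketWithin ℝ V W s e = lieBracket ℝ V W e := by
    rintro V W _ rfl e; rw [lieBracketWithin_univ]
  exact (h3 _ _ _ (by simp) _).trans h2

theorem nijenhuis_eq_fderiv {A : Π y : P, TangentSpace 𝓘(ℝ, E) y →L[ℝ] TangentSpace 𝓘(ℝ, E) y}
    (hA : DifferentiableAt ℝ (endCoord A p) (extChartAt 𝓘(ℝ, E) p p))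
    {X Y : Π y : P, TangentSpace 𝓘(ℝ, E) y}
    (hX : DifferentiableAt ℝ (fieldCoord X p) (extChartAt 𝓘(ℝ, E) p p))
    (hY : DifferentiableAt ℝ (fieldCoord Y p) (extChartAt 𝓘(ℝ, E) p p))
    {x y : E} (hx : X p = x) (hy : Y p = y) :
    nijenhuis A X Y p =
      fderiv ℝ (endCoord A p) (extChartAt 𝓘(ℝ, E) p p)
        (endCoord A p (extChartAt 𝓘(ℝ, E) p p) x) y
      - fderiv ℝ (endCoord A p) (extChartAt 𝓘(ℝ, E) p p)
        (endCoord A p (extChartAt 𝓘(ℝ, E) p p) y) x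
      - endCoord A p (extChartAt 𝓘(ℝ, E) p p)
        (fderiv ℝ (endCoord A p) (extChartAt 𝓘(ℝ, E) p p) x y)
      + endCoord A p (extChartAt 𝓘(ℝ, E) p p)
        (fderiv ℝ (endCoord A p) (extChartAt 𝓘(ℝ, E) p p) y x) := by
  have hAX : ∀ X : Π y : P, TangentSpace 𝓘(ℝ, E) y,
      DifferentiableAt ℝ (fieldCoord X p) (extChartAt 𝓘(ℝ, E) p p) → ∀ v x : E, X p = x →
      fderiv ℝ (fieldCoord (fun y => A y (X y)) p) (extChartAt 𝓘(ℝ, E) p p) v =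
      fderiv ℝ (endCoord A p) (extChartAt 𝓘(ℝ, E) p p) v x +
        endCoord A p (extChartAt 𝓘(ℝ, E) p p)
          (fderiv ℝ (fieldCoord X p) (extChartAt 𝓘(ℝ, E) p p) v) := by
    intro X hX v x hx
    have : fieldCoord (fun y => A y (X y)) p =ᶠ[𝓝 (extChartAt 𝓘(ℝ, E) p p)]
        fun e => endCoord A p e (fieldCoord X p e) := by
      apply eventually_extChartAt
      filter_upwards [source_mem_nhds' (mem_extChartAt_source (I := 𝓘(ℝ, E)) p)] with y hy
      rw [fieldCoord_extChartAt _ hy, fieldCoord_extChartAt _ hy, endCoord_extChartAt A hy]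
      have : frame p (chartD E p y (X y)) y = X y := chartInvD_chartD hy _
      rw [this]
    rw [this.fderiv_eq, fderiv_clm_apply hA hX, add_apply, fieldCoord_self, hx]
    exact add_comm _ _
  have hAp : (A p : E →L[ℝ] E) = endCoord A p (extChartAt 𝓘(ℝ, E) p p) := by
    ext v; exact (endCoord_self A v).symm
  have h : ∀ (A' : E →L[ℝ] E) (B₁ B₂ B₃ B₄ : E), A p = A' → mlieBracket 𝓘(ℝ, E) X Y p = B₁ →
      mlieBracket 𝓘(ℝ, E) (fun y => A y (X y)) (fun y => A y (Y y)) p = B₂ →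
      mlieBracket 𝓘(ℝ, E) (fun y => A y (X y)) Y p = B₃ →
      mlieBracket 𝓘(ℝ, E) X (fun y => A y (Y y)) p = B₄ →
      (nijenhuis A X Y p : E) = A' (A' B₁) + B₂ - A' B₃ - A' B₄ := by
    rintro _ _ _ _ _ rfl rfl rfl rfl rfl
    rfl
  have hAp' : ∀ {v w : E}, v = w → A p v = endCoord A p (extChartAt 𝓘(ℝ, E) p p) w := by
    rintro v _ rfl; exact (endCoord_self A v).symm
  rw [h _ _ _ _ _ hAp (mlieBracket_eq_fderiv hx hy)
    (mlieBracket_eq_fderiv (hAp' hx) (hAp' hy)) (mlieBracket_eq_fderiv (hAp' hx) hy)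
    (mlieBracket_eq_fderiv hx (hAp' hy)), hAX X hX _ _ hx, hAX Y hY _ _ hy, hAX X hX _ _ hx,
    hAX Y hY _ _ hy]
  simp only [map_add, map_sub]
  abel

end Chart

/-! ### The Levi-Civita connection in a chart -/

namespace SemiRiemannianMetric

variable {E : Type*} [NormedAddCommGroup E] [NormedSpace ℝ E]
  {P : Type*} [TopologicalSpace P] [ChartedSpace E P] {p : P} [IsManifold 𝓘(ℝ, E) ∞ P]
  (g : SemiRiemannianMetric E P)

theorem coord_extChartAt {y : P} (hy : y ∈ (extChartAt 𝓘(ℝ, E) p).source) (a b : E) :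
    g.coord p (extChartAt 𝓘(ℝ, E) p y) a b = g.inner y (frame p a y) (frame p b y) := by
  have : ∀ z, z = y → ∀ v w : E, (g.inner z v w : ℝ) = g.inner y v w := by
    rintro z rfl v w; rfl
  exact this _ ((extChartAt 𝓘(ℝ, E) p).left_inv hy) _ _

theorem coord_self (a b : E) :
    g.coord p (extChartAt 𝓘(ℝ, E) p p) a b = g.inner p a b := by
  rw [coord_extChartAt g (mem_extChartAt_source p), frame_self, frame_self]

theorem coord_symm (e a b : E) : g.coord p e a b = g.coord p e b a :=
  g.symm ((extChartAt 𝓘(ℝ, E) p).symm e) (chartInvD p e a) (chartInvD p e b)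

theorem contDiffAt_coord : ContDiffAt ℝ ∞ (g.coord p) (extChartAt 𝓘(ℝ, E) p p) := by
  have h := ((contMDiffAt_hom_bundle (F₁ := E) (F₂ := E →L[ℝ] ℝ)
    (E₁ := fun y : P => TangentSpace 𝓘(ℝ, E) y)
    (E₂ := fun y : P => TangentSpace 𝓘(ℝ, E) y →L[ℝ] Trivial P ℝ y) _).1
    (g.contMDiff.contMDiffAt (x := p))).2
  refine contDiffAt_of_contMDiffAt_comp (E := E) h ?_
  filter_upwards [source_mem_nhds' (mem_extChartAt_source (I := 𝓘(ℝ, E)) p)] with y hy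
  ext a b
  rw [coord_extChartAt g hy]
  have hy' : y ∈ (trivializationAt E (TangentSpace 𝓘(ℝ, E)) p).baseSet := by simpa using hy
  refine (inCoordinates_apply_eq₂ (F₁ := E) (F₂ := E) (F₃ := ℝ)
    (E₁ := fun y : P => TangentSpace 𝓘(ℝ, E) y) (E₂ := fun y : P => TangentSpace 𝓘(ℝ, E) y)
    (E₃ := Trivial P ℝ) hy' hy' (mem_univ _)).trans ?_
  have h1 : ∀ a : E, (trivializationAt E (TangentSpace 𝓘(ℝ, E)) p).symm y a = frame p a y :=
    fun a => (Trivialization.symmL_apply (R := ℝ) _ hy' a).symm.trans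
      (DFunLike.congr_fun (symmL_eq_chartInvD hy) a)
  rw [h1, h1]
  simp

theorem differentiableAt_coord :
    DifferentiableAt ℝ (g.coord p) (extChartAt 𝓘(ℝ, E) p p) :=
  g.contDiffAt_coord.differentiableAt (by simp)

theorem fderiv_coord_symm (x a b : E) :
    fderiv ℝ (g.coord p) (extChartAt 𝓘(ℝ, E) p p) x a b =
      fderiv ℝ (g.coord p) (extChartAt 𝓘(ℝ, E) p p) x b a := by
  have h : ∀ a b : E, fderiv ℝ (g.coord p) (extChartAt 𝓘(ℝ, E) p p) x a b =
      fderiv ℝ (fun e => g.coord p e a b) (extChartAt 𝓘(ℝ, E) p p) x := by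
    intro a b
    rw [fderiv_bilin_apply g.differentiableAt_coord (differentiableAt_const a)
      (differentiableAt_const b)]
    simp
  rw [h, h]
  simp only [g.coord_symm _ a b]

theorem christoffel_symm [FiniteDimensional ℝ E] (a b : E) :
    g.christoffel p a b = g.christoffel p b a := by
  have h : g.inner p (g.christoffel p a b) = g.inner p (g.christoffel p b a) := by
    ext c
    refine (g.inner_christoffel p a b c).trans (Eq.trans ?_ (g.inner_christoffel p b a c).symm)
    rw [g.fderiv_coord_symm c a b]
    ring
  have h2 := g.nondegenerate p (g.christoffel p a b - g.christoffel p b a) fun w => by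
    have := DFunLike.congr_fun h w
    have h3 := map_sub (g.inner p) (g.christoffel p a b) (g.christoffel p b a)
    exact (DFunLike.congr_fun h3 w).trans (sub_eq_zero.2 this)
  exact sub_eq_zero.1 h2

theorem fderiv_coord [FiniteDimensional ℝ E] (x a b : E) :
    fderiv ℝ (g.coord p) (extChartAt 𝓘(ℝ, E) p p) x a b =
      g.coord p (extChartAt 𝓘(ℝ, E) p p) (g.christoffel p x a) b +
        g.coord p (extChartAt 𝓘(ℝ, E) p p) a (g.christoffel p x b) := by
  rw [g.coord_symm _ a, g.coord_self, g.coord_self]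
  have h1 := g.inner_christoffel p x a b
  have h2 := g.inner_christoffel p x b a
  rw [g.fderiv_coord_symm x b a] at h2
  linarith

end SemiRiemannianMetric

/-! ### The covariant derivative of a tensor field of type `(1,1)` -/

namespace SemiRiemannianMetric

variable {E : Type*} [NormedAddCommGroup E] [NormedSpace ℝ E] [FiniteDimensional ℝ E]
  {P : Type*} [TopologicalSpace P] [ChartedSpace E P] {p : P} [IsManifold 𝓘(ℝ, E) ∞ P]
  (g : SemiRiemannianMetric E P)

omit [FiniteDimensional ℝ E] in
theorem inner_neg_left (x : P) (a b : TangentSpace 𝓘(ℝ, E) x) :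
    g.inner x (-a) b = -g.inner x a b := by
  rw [g.symm, map_neg, g.symm]

/-- The covariant derivative `(∇_x A) a` of a `(1,1)`-tensor field at `p`, for the Levi-Civita
connection of `g`, computed in the chart at `p`. -/
noncomputable def covTensor (A : Π y : P, TangentSpace 𝓘(ℝ, E) y →L[ℝ] TangentSpace 𝓘(ℝ, E) y)
    (p : P) (x a : TangentSpace 𝓘(ℝ, E) p) : TangentSpace 𝓘(ℝ, E) p :=
  covEnd (E := E) (g.christoffel p) (endCoord A p) (extChartAt 𝓘(ℝ, E) p p) x a

omit [FiniteDimensional ℝ E] in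
/-- The product rule `∇(A ∘ B) = (∇A) ∘ B + A ∘ ∇B`. -/
theorem covTensor_comp
    {A B D : Π y : P, TangentSpace 𝓘(ℝ, E) y →L[ℝ] TangentSpace 𝓘(ℝ, E) y}
    (hA : DifferentiableAt ℝ (endCoord A p) (extChartAt 𝓘(ℝ, E) p p))
    (hB : DifferentiableAt ℝ (endCoord B p) (extChartAt 𝓘(ℝ, E) p p))
    (h : ∀ᶠ y in 𝓝 p, ∀ a, D y a = A y (B y a)) (x a : TangentSpace 𝓘(ℝ, E) p) :
    g.covTensor D p x a = g.covTensor A p x (B p a) + A p (g.covTensor B p x a) := by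
  have key := covEnd_comp (E := E) (Γ := g.christoffel p) (K := endCoord D p) hA hB ?_ x a
  · refine key.trans ?_
    exact congrArg₂ (fun s t : E => covEnd (E := E) (g.christoffel p) (endCoord A p)
      (extChartAt 𝓘(ℝ, E) p p) x s + t) (endCoord_self B a) (endCoord_self A _)
  · apply eventually_extChartAt
    filter_upwards [source_mem_nhds' (mem_extChartAt_source (I := 𝓘(ℝ, E)) p), h] with y hy h
    ext a
    rw [ContinuousLinearMap.comp_apply, endCoord_extChartAt _ hy, endCoord_extChartAt _ hy,
      frame_endCoord hy, h]

/-- If `dα = g(·, K·) + σ ∧ β` and `dβ = g(·, K'·)` on horizontal vectors, those in the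
kernel of `α` and `β`, and if the Nijenhuis tensor of `K` satisfies `hN` on them, then the
horizontal part of `(∇_a K) b` is that of `σ(a) K' b`. With `(u, v, G, H)` or
`(v, -u, H, -G)` for `(α, β, K, K')` this applies to both local tensors of a
normal complex contact metric structure. -/
theorem inner_covTensor_of_normal {s : Set P} (hs : IsOpen s) (hp : p ∈ s)
    {α β σ : Π y : P, TangentSpace 𝓘(ℝ, E) y →L[ℝ] ℝ}
    {K K' : Π y : P, TangentSpace 𝓘(ℝ, E) y →L[ℝ] TangentSpace 𝓘(ℝ, E) y}
    (hα : ContDiffAt ℝ ∞ (formCoord α p) (extChartAt 𝓘(ℝ, E) p p))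
    (hβ : ContDiffAt ℝ ∞ (formCoord β p) (extChartAt 𝓘(ℝ, E) p p))
    (hσ : ContDiffAt ℝ ∞ (formCoord σ p) (extChartAt 𝓘(ℝ, E) p p))
    (hK : ContDiffAt ℝ ∞ (endCoord K p) (extChartAt 𝓘(ℝ, E) p p))
    (hskew : ∀ y ∈ s, ∀ a b, g.inner y (K y a) b = -g.inner y a (K y b))
    (hiso : ∀ y ∈ s, ∀ a b, g.inner y (K y a) (K y b) =
      g.inner y a b - α y a * α y b - β y a * β y b)
    (hdα : ∀ y ∈ s, ∀ X Y : Π y : P, TangentSpace 𝓘(ℝ, E) y, SmoothNear X y → SmoothNear Y y →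
      extDerivForm α X Y y = g.inner y (X y) (K y (Y y)) + wedge σ β X Y y)
    (hdβ : ∀ X Y : Π y : P, TangentSpace 𝓘(ℝ, E) y, SmoothNear X p → SmoothNear Y p →
      α p (X p) = 0 → α p (Y p) = 0 → extDerivForm β X Y p = g.inner p (X p) (K' p (Y p)))
    (hskew' : ∀ a b, g.inner p (K' p a) b = -g.inner p a (K' p b))
    (hKα : ∀ a, α p (K p a) = 0) (hKβ : ∀ a, β p (K p a) = 0)
    (hKK : ∀ a, α p a = 0 → β p a = 0 → K p (K p a) = -a)
    (hanti : ∀ a, K' p (K p a) = -K p (K' p a))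
    (hext : ∀ a : TangentSpace 𝓘(ℝ, E) p, α p a = 0 → β p a = 0 →
      ∃ X : Π y : P, TangentSpace 𝓘(ℝ, E) y, SmoothNear X p ∧ X p = a ∧
        ∀ᶠ y in 𝓝 p, α y (X y) = 0 ∧ β y (X y) = 0)
    (hN : ∀ X Y : Π y : P, TangentSpace 𝓘(ℝ, E) y, SmoothNear X p → SmoothNear Y p →
      (∀ᶠ y in 𝓝 p, α y (X y) = 0 ∧ β y (X y) = 0) →
      (∀ᶠ y in 𝓝 p, α y (Y y) = 0 ∧ β y (Y y) = 0) →
      ∀ w : TangentSpace 𝓘(ℝ, E) p, α p w = 0 → β p w = 0 →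
      g.inner p w (nijenhuis K X Y p + σ p (K p (Y p)) • K' p (X p) - σ p (K p (X p)) • K' p (Y p)
        + σ p (X p) • K p (K' p (Y p)) - σ p (Y p) • K p (K' p (X p))) = 0)
    {a b c : E} (ha : α p a = 0) (ha' : β p a = 0) (hb : α p b = 0) (hb' : β p b = 0)
    (hc : α p c = 0) (hc' : β p c = 0) :
    g.inner p (g.covTensor K p a b) c = σ p a * g.inner p (K' p b) c := by
  have : CompleteSpace E := FiniteDimensional.complete ℝ E
  set e := extChartAt 𝓘(ℝ, E) p p with he
  have hsrc := source_mem_nhds' (mem_extChartAt_source (I := 𝓘(ℝ, E)) p)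
  have hsn := hs.mem_nhds hp
  let L : E →L[ℝ] E := K' p
  have hαe : ∀ v : E, formCoord α p e v = α p v := formCoord_self α
  have hβe : ∀ v : E, formCoord β p e v = β p v := formCoord_self β
  have hσe : ∀ v : E, formCoord σ p e v = σ p v := formCoord_self σ
  have hKe : ∀ v : E, endCoord K p e v = K p v := endCoord_self K
  let Kp : E →L[ℝ] E := K p
  let σp : E →L[ℝ] ℝ := σ p
  have hKp : endCoord K p e = Kp := ContinuousLinearMap.ext hKe
  have hσp : formCoord σ p e = σp := ContinuousLinearMap.ext hσe
  have hge : ∀ v w : E, g.coord p e v w = g.inner p v w := g.coord_self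
  have hα1 : ∀ᶠ y in 𝓝 p, DifferentiableAt ℝ (formCoord α p) (extChartAt 𝓘(ℝ, E) p y) := by
    have h1 := ((hα.of_le (m := 1) (by exact_mod_cast le_top)).eventually (by simp)).mono
      fun y hy => hy.differentiableAt (by simp)
    exact (continuousAt_extChartAt p).eventually h1
  have main := inner_covEnd_eq (E := E) (e := e) (g := g.coord p) (Γ := g.christoffel p)
    (K := endCoord K p) (α := formCoord α p) (β := formCoord β p) (σ := formCoord σ p) (K' := L)
    g.differentiableAt_coord (hK.differentiableAt (by simp))
    (hα.of_le (WithTop.coe_le_coe.2 (le_top : (2 : ℕ∞) ≤ ⊤))) (hβ.differentiableAt (by simp))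
    (hσ.differentiableAt (by simp)) (g.coord_symm e) g.fderiv_coord g.christoffel_symm
    ?_ ?_ ?_ ?_ ?_ ?_ ?_ ?_ ?_ (a := a) (b := b) (c := c)
    ((hαe a).trans ha) ((hβe a).trans ha') ((hαe b).trans hb) ((hβe b).trans hb')
    ((hαe c).trans hc) ((hβe c).trans hc')
  · rw [hge, hge, hσe] at main
    exact main
  · apply eventually_extChartAt
    filter_upwards [hsrc, hsn] with y hy hys a b
    rw [g.coord_extChartAt hy, g.coord_extChartAt hy, frame_endCoord hy, frame_endCoord hy]
    exact hskew y hys _ _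
  · apply eventually_extChartAt
    filter_upwards [hsrc, hsn] with y hy hys a b
    rw [g.coord_extChartAt hy, g.coord_extChartAt hy, frame_endCoord hy, frame_endCoord hy,
      formCoord_extChartAt α hy, formCoord_extChartAt α hy, formCoord_extChartAt β hy,
      formCoord_extChartAt β hy]
    exact hiso y hys _ _
  · apply eventually_extChartAt
    filter_upwards [hsrc, hsn, hα1] with y hy hys hd a b
    rw [← extDerivForm_frame hy hd, hdα y hys _ _ (smoothNear_frame hy a) (smoothNear_frame hy b),
      g.coord_extChartAt hy, frame_endCoord hy, formCoord_extChartAt σ hy,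
      formCoord_extChartAt σ hy, formCoord_extChartAt β hy, formCoord_extChartAt β hy]
    rfl
  · intro a b ha ha' hb hb'
    have hy := mem_extChartAt_source (I := 𝓘(ℝ, E)) p
    rw [← extDerivForm_frame hy (hβ.differentiableAt (by simp)),
      hdβ _ _ (smoothNear_frame hy a) (smoothNear_frame hy b), frame_self, frame_self, hge]
    · rfl
    · rw [frame_self, ← hαe]; exact ha
    · rw [frame_self, ← hαe]; exact hb
  · intro a b
    rw [hge, hge]
    exact hskew' a b
  · intro a _ _
    rw [hαe, hβe, hKe]
    exact ⟨hKα a, hKβ a⟩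
  · intro a ha ha'
    rw [hKp]
    exact hKK a ((hαe a).symm.trans ha) ((hβe a).symm.trans ha')
  · intro a _ _
    rw [hKp]
    exact hanti a
  · intro a b w ha ha' hb hb' hw hw'
    obtain ⟨X, hX, hXa, hX'⟩ := hext a ((hαe a).symm.trans ha) ((hβe a).symm.trans ha')
    obtain ⟨Y, hY, hYb, hY'⟩ := hext b ((hαe b).symm.trans hb) ((hβe b).symm.trans hb')
    have h1 := hN X Y hX hY hX' hY' w ((hαe w).symm.trans hw) ((hβe w).symm.trans hw')
    have hn := nijenhuis_eq_fderiv (hK.differentiableAt (by simp))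
      ((contDiffAt_fieldCoord hX.self_of_nhds).differentiableAt (by simp))
      ((contDiffAt_fieldCoord hY.self_of_nhds).differentiableAt (by simp)) hXa hYb
    rw [hn, hXa, hYb, ← he, hKp] at h1
    rw [hge, hKp, hσp]
    exact h1

end SemiRiemannianMetric

/-! ### Algebra of a complex contact metric structure -/

section Tensors

theorem extDerivForm_neg {E : Type*} [NormedAddCommGroup E] [NormedSpace ℝ E]
    {P : Type*} [TopologicalSpace P] [ChartedSpace E P]
    (α : Π y : P, TangentSpace 𝓘(ℝ, E) y →L[ℝ] ℝ) (X Y : Π y : P, TangentSpace 𝓘(ℝ, E) y) (x : P) :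
    extDerivForm (fun y => -α y) X Y x = -extDerivForm α X Y x := by
  have h : ∀ X : Π y : P, TangentSpace 𝓘(ℝ, E) y,
      mvfderiv 𝓘(ℝ, E) (fun y => (-α y) (X y)) x = -mvfderiv 𝓘(ℝ, E) (fun y => α y (X y)) x :=
    fun X => mvfderiv_neg
  rw [extDerivForm, extDerivForm, h, h, smul_eq_mul, smul_eq_mul, neg_apply, neg_apply, neg_apply]
  ring

variable {E : Type*} [NormedAddCommGroup E] [NormedSpace ℂ E]
  {P : Type*} [TopologicalSpace P] [ChartedSpace E P]

theorem J_J {x : P} (a : TangentSpace 𝓘(ℝ, E) x) : J x (J x a) = -a := by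
  have h : ∀ a : E, Complex.I • Complex.I • a = -a := fun a => by
    rw [smul_smul, Complex.I_mul_I, neg_one_smul]
  exact h a

variable [IsManifold 𝓘(ℂ, E) ∞ P]

namespace ComplexContactMetricStructure

variable {ι : Type*} {n : ℕ} (C : ComplexContactMetricStructure E P ι n) {i : ι} {x : P}

theorem J_skew (a b : TangentSpace 𝓘(ℝ, E) x) : C.g.inner x (J x a) b = -C.g.inner x a (J x b) := by
  rw [← C.hermitian x a (J x b), J_J, map_neg, neg_neg]

theorem v_U (hx : x ∈ C.O i) : C.v i x (C.U i x) = 0 := by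
  have h := C.J_skew (C.U i x) (C.U i x)
  rw [C.g.symm, C.U_dual i x hx] at h
  rw [C.v_eq i x hx]
  linarith

theorem u_J (hx : x ∈ C.O i) (a : TangentSpace 𝓘(ℝ, E) x) : C.u i x (J x a) = C.v i x a :=
  (C.v_eq i x hx a).symm

theorem v_J (hx : x ∈ C.O i) (a : TangentSpace 𝓘(ℝ, E) x) : C.v i x (J x a) = -C.u i x a := by
  rw [C.v_eq i x hx, J_J, map_neg]

theorem u_V (hx : x ∈ C.O i) : C.u i x (C.V i x) = 0 := by
  rw [C.V_eq i x hx, map_neg, C.u_J hx, C.v_U hx, neg_zero]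

theorem v_V (hx : x ∈ C.O i) : C.v i x (C.V i x) = 1 := by
  rw [C.V_eq i x hx, map_neg, C.v_J hx, C.u_U i x hx, neg_neg]

theorem V_dual (hx : x ∈ C.O i) (a : TangentSpace 𝓘(ℝ, E) x) :
    C.g.inner x (C.V i x) a = C.v i x a := by
  rw [C.V_eq i x hx, map_neg, neg_apply, C.J_skew, neg_neg, C.U_dual i x hx, C.u_J hx]

theorem G_V (hx : x ∈ C.O i) : C.G i x (C.V i x) = 0 := by
  rw [C.V_eq i x hx, map_neg, C.G_J i x hx, C.G_U i x hx, map_zero, neg_zero, neg_zero]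

theorem u_G (hx : x ∈ C.O i) (a : TangentSpace 𝓘(ℝ, E) x) : C.u i x (C.G i x a) = 0 := by
  rw [← C.U_dual i x hx, ← neg_eq_zero, ← C.G_skew i x hx, C.G_U i x hx, map_zero, zero_apply]

theorem v_G (hx : x ∈ C.O i) (a : TangentSpace 𝓘(ℝ, E) x) : C.v i x (C.G i x a) = 0 := by
  rw [← C.V_dual hx, ← neg_eq_zero, ← C.G_skew i x hx, C.G_V hx, map_zero, zero_apply]

theorem u_H (hx : x ∈ C.O i) (a : TangentSpace 𝓘(ℝ, E) x) : C.u i x (C.H i x a) = 0 := by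
  rw [C.H_eq i x hx, C.u_G hx]

theorem v_H (hx : x ∈ C.O i) (a : TangentSpace 𝓘(ℝ, E) x) : C.v i x (C.H i x a) = 0 := by
  rw [C.H_eq i x hx, C.v_G hx]

theorem H_skew (hx : x ∈ C.O i) (a b : TangentSpace 𝓘(ℝ, E) x) :
    C.g.inner x (C.H i x a) b = -C.g.inner x a (C.H i x b) := by
  rw [C.H_eq i x hx, C.H_eq i x hx, C.G_skew i x hx, C.J_skew, C.G_J i x hx, map_neg]

theorem inner_U (hx : x ∈ C.O i) (a : TangentSpace 𝓘(ℝ, E) x) :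
    C.g.inner x a (C.U i x) = C.u i x a := by
  rw [C.g.symm, C.U_dual i x hx]

theorem inner_V (hx : x ∈ C.O i) (a : TangentSpace 𝓘(ℝ, E) x) :
    C.g.inner x a (C.V i x) = C.v i x a := by
  rw [C.g.symm, C.V_dual hx]

theorem G_isometry (hx : x ∈ C.O i) (a b : TangentSpace 𝓘(ℝ, E) x) :
    C.g.inner x (C.G i x a) (C.G i x b) =
      C.g.inner x a b - C.u i x a * C.u i x b - C.v i x a * C.v i x b := by
  rw [C.G_skew i x hx, C.G_sq i x hx, map_add, map_add, map_smul, map_smul, C.inner_U hx,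
    C.inner_V hx, map_neg, smul_eq_mul, smul_eq_mul]
  ring

theorem H_isometry (hx : x ∈ C.O i) (a b : TangentSpace 𝓘(ℝ, E) x) :
    C.g.inner x (C.H i x a) (C.H i x b) =
      C.g.inner x a b - C.u i x a * C.u i x b - C.v i x a * C.v i x b := by
  rw [C.H_skew hx, C.H_sq i x hx, map_add, map_add, map_smul, map_smul, C.inner_U hx,
    C.inner_V hx, map_neg, smul_eq_mul, smul_eq_mul]
  ring

theorem G_H (hx : x ∈ C.O i) (a : TangentSpace 𝓘(ℝ, E) x) :
    C.G i x (C.H i x a) = -J x a + C.v i x a • C.U i x - C.u i x a • C.V i x := by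
  rw [C.H_eq i x hx, C.G_sq i x hx, C.u_J hx, C.v_J hx, neg_smul, sub_eq_add_neg]

theorem H_G (hx : x ∈ C.O i) (a : TangentSpace 𝓘(ℝ, E) x) :
    C.H i x (C.G i x a) = -C.G i x (C.H i x a) := by
  rw [C.H_eq i x hx, C.H_eq i x hx, C.G_J i x hx a, map_neg, neg_neg]

theorem H_J (hx : x ∈ C.O i) (a : TangentSpace 𝓘(ℝ, E) x) : C.H i x (J x a) = -C.G i x a := by
  rw [C.H_eq i x hx, J_J, map_neg]

/-! ### The covariant derivatives of the structure tensors -/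

/-- Horizontal vectors extend to horizontal vector fields. -/
theorem exists_horizontalNear [FiniteDimensional ℝ E] (hx : x ∈ C.O i)
    (a : TangentSpace 𝓘(ℝ, E) x) (ha : C.u i x a = 0) (ha' : C.v i x a = 0) :
    ∃ X : Π y : P, TangentSpace 𝓘(ℝ, E) y, SmoothNear X x ∧ X x = a ∧ C.HorizontalNear i X x := by
  have : CompleteSpace E := FiniteDimensional.complete ℝ E
  obtain ⟨su, sv, sU, sV, -⟩ := C.smooth i
  have hO := (C.isOpen i).mem_nhds hx
  refine ⟨fun y => frame (E := E) x a y - C.u i y (frame (E := E) x a y) • C.U i y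
    - C.v i y (frame (E := E) x a y) • C.V i y, ?_, ?_, ?_⟩
  · filter_upwards [source_mem_nhds' (mem_extChartAt_source (I := 𝓘(ℝ, E)) x), hO] with y hy hyO
    have hn := (C.isOpen i).mem_nhds hyO
    have hf := contMDiffAt_frame (E := E) hy a
    exact (hf.sub_section ((contMDiffAt_form_apply su hn hf).smul_section
      (ContMDiffOn.contMDiffAt sU hn))).sub_section ((contMDiffAt_form_apply sv hn hf).smul_section
      (ContMDiffOn.contMDiffAt sV hn))
  · have hf : frame (E := E) x a x = a := frame_self (E := E) x a
    simp only [hf, ha, ha', zero_smul, sub_zero]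
  · filter_upwards [hO] with y hy
    simp only [map_sub, map_smul, smul_eq_mul, C.u_U i y hy, C.u_V hy, C.v_U hy, C.v_V hy]
    constructor <;> ring

variable {p : P}

theorem differentiableAt_endCoord_J [FiniteDimensional ℝ E] (hp : p ∈ C.O i) :
    DifferentiableAt ℝ (endCoord (J (P := P)) p) (extChartAt 𝓘(ℝ, E) p p) := by
  obtain ⟨su, sv, sU, sV, sG, sH, -⟩ := C.smooth i
  have hn := (C.isOpen i).mem_nhds hp
  have dG := (contDiffAt_endCoord sG hn)
  have dH := (contDiffAt_endCoord sH hn)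
  have du := (contDiffAt_formCoord su hn)
  have dv := (contDiffAt_formCoord sv hn)
  have dU := (contDiffAt_fieldCoord (ContMDiffOn.contMDiffAt sU hn))
  have dV := (contDiffAt_fieldCoord (ContMDiffOn.contMDiffAt sV hn))
  -- `J = -GH + v ⊗ U - u ⊗ V` is built from smooth tensor fields
  refine (((((dG.clm_comp dH).neg).add (dv.smulRight dU)).sub
    (du.smulRight dV)).congr_of_eventuallyEq ?_).differentiableAt (by simp)
  apply eventually_extChartAt
  filter_upwards [source_mem_nhds' (mem_extChartAt_source (I := 𝓘(ℝ, E)) p), hn] with y hy hyO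
  ext a
  have h1 := congrArg (chartD E p y) (C.G_H hyO (frame (E := E) p a y))
  have h2 : ∀ (A : E →L[ℝ] E) (w j U V : E) (s t : ℝ), A w = A (-j + s • U - t • V) →
      A j = -A w + s • A U - t • A V := by
    intro A w j U V s t h
    rw [h]; simp only [map_add, map_sub, map_smul, map_neg]; abel
  have h3 := h2 _ _ _ _ _ _ _ h1
  simp only [sub_apply, add_apply, neg_apply,
    ContinuousLinearMap.smulRight_apply, ContinuousLinearMap.comp_apply]
  rw [endCoord_extChartAt _ hy, formCoord_extChartAt _ hy, formCoord_extChartAt _ hy,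
    fieldCoord_extChartAt _ hy, fieldCoord_extChartAt _ hy, endCoord_extChartAt _ hy,
    frame_endCoord hy]
  exact h3

/-- On horizontal vectors `(∇_a G) b = σ(a) H b`, up to a vector orthogonal to the horizontal
space. -/
theorem inner_covTensor_G [FiniteDimensional ℝ E] (hC : C.IsNormal) (hp : p ∈ C.O i)
    {a b c : TangentSpace 𝓘(ℝ, E) p} (ha : C.u i p a = 0) (ha' : C.v i p a = 0)
    (hb : C.u i p b = 0) (hb' : C.v i p b = 0) (hc : C.u i p c = 0) (hc' : C.v i p c = 0) :
    C.g.inner p (C.g.covTensor (C.G i) p a b) c = C.σ i p a * C.g.inner p (C.H i p b) c := by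
  obtain ⟨su, sv, sU, sV, sG, sH, sσ⟩ := C.smooth i
  have hn := (C.isOpen i).mem_nhds hp
  refine C.g.inner_covTensor_of_normal (s := C.O i) (α := C.u i) (β := C.v i) (σ := C.σ i)
    (K := C.G i) (K' := C.H i) (C.isOpen i) hp (contDiffAt_formCoord su hn)
    (contDiffAt_formCoord sv hn) (contDiffAt_formCoord sσ hn) (contDiffAt_endCoord sG hn)
    (fun y hy => C.G_skew i y hy) (fun y hy => C.G_isometry hy) (fun y hy => C.du i y hy) ?_
    (C.H_skew hp) (C.u_G hp) (C.v_G hp) ?_ (C.H_G hp)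
    (fun a h h' => C.exists_horizontalNear hp a h h') ?_ ha ha' hb hb' hc hc'
  · intro X Y hX hY h h'
    rw [C.dv i p hp X Y hX hY, wedge, h, h', mul_zero, mul_zero, sub_zero, mul_zero, sub_zero]
  · intro a h h'
    rw [C.G_sq i p hp, h, h', zero_smul, zero_smul, add_zero, add_zero]
  · intro X Y hX hY hX' hY' w hw hw'
    have h := ((hC i p hp).1 X Y hX hY hX' hY').1
    have h1 := congrArg (C.g.inner p w) h
    simp only [tensorS, hX'.self_of_nhds.2, hY'.self_of_nhds.2, zero_smul, sub_zero, smul_zero,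
      add_zero, map_zero] at h1
    rw [← h1]
    simp only [map_add, map_sub, map_smul, C.inner_U hp, C.inner_V hp, hw, hw', smul_eq_mul,
      mul_zero, add_zero, sub_zero]

/-- On horizontal vectors `(∇_a H) b = -σ(a) G b`, up to a vector orthogonal to the horizontal
space. -/
theorem inner_covTensor_H [FiniteDimensional ℝ E] (hC : C.IsNormal) (hp : p ∈ C.O i)
    {a b c : TangentSpace 𝓘(ℝ, E) p} (ha : C.u i p a = 0) (ha' : C.v i p a = 0)
    (hb : C.u i p b = 0) (hb' : C.v i p b = 0) (hc : C.u i p c = 0) (hc' : C.v i p c = 0) :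
    C.g.inner p (C.g.covTensor (C.H i) p a b) c = -C.σ i p a * C.g.inner p (C.G i p b) c := by
  obtain ⟨su, sv, sU, sV, sG, sH, sσ⟩ := C.smooth i
  have hn := (C.isOpen i).mem_nhds hp
  have hu : ∀ y (a : TangentSpace 𝓘(ℝ, E) y), (-C.u i y) a = -C.u i y a := fun _ _ => rfl
  have hG : ∀ y (a : TangentSpace 𝓘(ℝ, E) y), (-C.G i y) a = -C.G i y a := fun _ _ => rfl
  -- `(v, -u, H, -G)` satisfies the same structure equations as `(u, v, G, H)`
  have key := C.g.inner_covTensor_of_normal (s := C.O i) (α := C.v i) (β := fun y => -C.u i y)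
    (σ := C.σ i) (K := C.H i) (K' := fun y => -C.G i y) (C.isOpen i) hp
    (contDiffAt_formCoord sv hn) (contDiffAt_formCoord su hn).neg (contDiffAt_formCoord sσ hn)
    (contDiffAt_endCoord sH hn) (fun y hy => C.H_skew hy) ?_ ?_ ?_ ?_ (C.v_H hp) ?_ ?_ ?_ ?_ ?_
    (a := a) (b := b) (c := c) ha' (neg_eq_zero.2 ha) hb' (neg_eq_zero.2 hb) hc' (neg_eq_zero.2 hc)
  · rw [key, neg_mul, ← mul_neg]
    congr 1
    change C.g.inner p (-(C.G i p b)) c = _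
    rw [C.g.inner_neg_left]
  · intro y hy a b
    rw [C.H_isometry hy, hu, hu]
    ring
  · intro y hy X Y hX hY
    rw [C.dv i y hy X Y hX hY, wedge, wedge, hu, hu]
    ring
  · intro X Y hX hY h h'
    rw [extDerivForm_neg, C.du i p hp X Y hX hY, wedge, h, h', hG, map_neg]
    ring
  · intro a b
    rw [hG, hG, C.g.inner_neg_left, map_neg, C.G_skew i p hp]
  · intro a
    rw [hu, C.u_H hp, neg_zero]
  · intro a h h'
    rw [C.H_sq i p hp, h, show C.u i p a = 0 from neg_eq_zero.1 h', zero_smul, zero_smul,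
      add_zero, add_zero]
  · intro a
    rw [hG, hG, map_neg, C.H_G hp, neg_neg]
  · intro a h h'
    obtain ⟨X, h1, h2, h3⟩ := C.exists_horizontalNear hp a (neg_eq_zero.1 h') h
    exact ⟨X, h1, h2, h3.mono fun y hy => ⟨hy.2, neg_eq_zero.2 hy.1⟩⟩
  · intro X Y hX hY hX' hY' w hw hw'
    have hw' : C.u i p w = 0 := neg_eq_zero.1 hw'
    have hX' : C.HorizontalNear i X p := hX'.mono fun y hy => ⟨neg_eq_zero.1 hy.2, hy.1⟩
    have hY' : C.HorizontalNear i Y p := hY'.mono fun y hy => ⟨neg_eq_zero.1 hy.2, hy.1⟩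
    have h := ((hC i p hp).1 X Y hX hY hX' hY').2
    have h1 := congrArg (C.g.inner p w) h
    simp only [tensorT, hX'.self_of_nhds.1, hY'.self_of_nhds.1, zero_smul, sub_zero, smul_zero,
      add_zero, map_zero] at h1
    rw [← h1]
    simp only [map_add, map_sub, map_smul, C.inner_U hp, C.inner_V hp, hw, hw', smul_eq_mul,
      mul_zero, add_zero, sub_zero, hG, map_neg, C.H_G hp]
    ring

/-- On horizontal vectors `(∇_a J) b` is orthogonal to the horizontal space: this is what `H = GJ`
and the formulas for `∇G` and `∇H` amount to. -/
theorem inner_covTensor_J [FiniteDimensional ℝ E] (hC : C.IsNormal) (hp : p ∈ C.O i)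
    {a b c : TangentSpace 𝓘(ℝ, E) p} (ha : C.u i p a = 0) (ha' : C.v i p a = 0)
    (hb : C.u i p b = 0) (hb' : C.v i p b = 0) (hc : C.u i p c = 0) (hc' : C.v i p c = 0) :
    C.g.inner p (C.g.covTensor (J (P := P)) p a b) c = 0 := by
  obtain ⟨su, sv, sU, sV, sG, sH, sσ⟩ := C.smooth i
  have hn := (C.isOpen i).mem_nhds hp
  have h1 : C.g.covTensor (C.H i) p a b =
      C.g.covTensor (C.G i) p a (J p b) + C.G i p (C.g.covTensor (J (P := P)) p a b) := by
    refine C.g.covTensor_comp ((contDiffAt_endCoord sG hn).differentiableAt (by simp))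
      (C.differentiableAt_endCoord_J hp) ?_ a b
    filter_upwards [hn] with y hy a
    exact C.H_eq i y hy a
  have hJ : C.u i p (J p b) = 0 ∧ C.v i p (J p b) = 0 :=
    ⟨(C.u_J hp _).trans hb', (C.v_J hp _).trans (neg_eq_zero.2 hb)⟩
  -- it suffices to test against `c = G(-G c)`
  have h2 : ∀ d : TangentSpace 𝓘(ℝ, E) p, C.u i p d = 0 → C.v i p d = 0 →
      C.g.inner p (C.g.covTensor (J (P := P)) p a b) (C.G i p d) = 0 := by
    intro d hd hd'
    have e1 := C.inner_covTensor_H hC hp ha ha' hb hb' hd hd'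
    have e2 := C.inner_covTensor_G hC hp ha ha' hJ.1 hJ.2 hd hd'
    have e3 := C.G_skew i p hp (C.g.covTensor (J (P := P)) p a b) d
    have e4 := C.H_J hp b
    rw [h1, C.g.symm, map_add, C.g.symm, C.g.symm p d, e2, e3, e4, C.g.inner_neg_left] at e1
    linarith
  have h3 := h2 (-C.G i p c) (by rw [map_neg, C.u_G hp, neg_zero])
    (by rw [map_neg, C.v_G hp, neg_zero])
  have h4 : C.G i p (-C.G i p c) = c := by
    rw [map_neg, C.G_sq i p hp, hc, hc', zero_smul, zero_smul, add_zero, add_zero, neg_neg]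
  rwa [h4] at h3

/-- On horizontal vectors `(∇_a J_m) b` is a multiple of some `J_k b`, up to a vector orthogonal to
the horizontal space. -/
theorem exists_inner_covTensor [FiniteDimensional ℝ E] (hC : C.IsNormal) (hp : p ∈ C.O i)
    (m : Fin 3) : ∃ (k : Fin 3) (τ : TangentSpace 𝓘(ℝ, E) p → ℝ),
      ∀ a b c : TangentSpace 𝓘(ℝ, E) p, C.u i p a = 0 → C.v i p a = 0 →
      C.u i p b = 0 → C.v i p b = 0 → C.u i p c = 0 → C.v i p c = 0 →
      C.g.inner p (C.g.covTensor (C.tensorJ i m) p a b) c =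
        τ a * C.g.inner p (C.tensorJ i k p b) c := by
  fin_cases m
  · exact ⟨0, fun _ => 0, fun a b c ha ha' hb hb' hc hc' => by
      rw [zero_mul]; exact C.inner_covTensor_J hC hp ha ha' hb hb' hc hc'⟩
  · exact ⟨2, fun a => C.σ i p a, fun a b c ha ha' hb hb' hc hc' =>
      C.inner_covTensor_G hC hp ha ha' hb hb' hc hc'⟩
  · exact ⟨1, fun a => -C.σ i p a, fun a b c ha ha' hb hb' hc hc' =>
      C.inner_covTensor_H hC hp ha ha' hb hb' hc hc'⟩

theorem differentiableAt_endCoord_tensorJ [FiniteDimensional ℝ E] (hp : p ∈ C.O i) (m : Fin 3) :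
    DifferentiableAt ℝ (endCoord (C.tensorJ i m) p) (extChartAt 𝓘(ℝ, E) p p) := by
  obtain ⟨su, sv, sU, sV, sG, sH, -⟩ := C.smooth i
  have hn := (C.isOpen i).mem_nhds hp
  fin_cases m
  · exact C.differentiableAt_endCoord_J hp
  · exact (contDiffAt_endCoord sG hn).differentiableAt (by simp)
  · exact (contDiffAt_endCoord sH hn).differentiableAt (by simp)

theorem tensorJ_skew (hp : p ∈ C.O i) (m : Fin 3) (a b : TangentSpace 𝓘(ℝ, E) p) :
    C.g.inner p (C.tensorJ i m p a) b = -C.g.inner p a (C.tensorJ i m p b) := by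
  fin_cases m
  · exact C.J_skew a b
  · exact C.G_skew i p hp a b
  · exact C.H_skew hp a b

end ComplexContactMetricStructure

end Tensors

/-! ### Vector fields along a map -/

section Along

variable {E : Type*} [NormedAddCommGroup E] [NormedSpace ℝ E]
  {P : Type*} [TopologicalSpace P] [ChartedSpace E P] [IsManifold 𝓘(ℝ, E) ∞ P]
  {F : Type*} [NormedAddCommGroup F] [NormedSpace ℝ F]
  {M : Type*} [TopologicalSpace M] [ChartedSpace F M] {f : M → P} {x : M}

/-- A vector field along `f` is differentiable at `x`: its components in the chart of `P` at `f x`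
are. -/
def DiffAlongAt (f : M → P) (s : Π y : M, TangentSpace 𝓘(ℝ, E) (f y)) (x : M) : Prop :=
  MDifferentiableAt 𝓘(ℝ, F) 𝓘(ℝ, E) (fun y => chartD E (f x) (f y) (s y)) x

theorem mvfderiv_clm_apply {A B : Type*} [NormedAddCommGroup A] [NormedSpace ℝ A]
    [NormedAddCommGroup B] [NormedSpace ℝ B] {c : M → A →L[ℝ] B} {a : M → A}
    (hc : MDifferentiableAt 𝓘(ℝ, F) 𝓘(ℝ, A →L[ℝ] B) c x)
    (ha : MDifferentiableAt 𝓘(ℝ, F) 𝓘(ℝ, A) a x) (v : TangentSpace 𝓘(ℝ, F) x) :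
    mvfderiv 𝓘(ℝ, F) (fun y => c y (a y)) x v =
      mvfderiv 𝓘(ℝ, F) c x v (a x) + c x (mvfderiv 𝓘(ℝ, F) a x v) := by
  have h1 : HasMFDerivAt 𝓘(ℝ, F) 𝓘(ℝ, (A →L[ℝ] B) × A) (fun y => (c y, a y)) x
      ((mfderiv 𝓘(ℝ, F) 𝓘(ℝ, A →L[ℝ] B) c x).prod (mfderiv 𝓘(ℝ, F) 𝓘(ℝ, A) a x)) :=
    ⟨hc.continuousAt.prodMk ha.continuousAt, hc.hasMFDerivAt.2.prodMk ha.hasMFDerivAt.2⟩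
  have h2 : HasMFDerivAt 𝓘(ℝ, F) 𝓘(ℝ, B) (fun y => c y (a y)) x _ :=
    ((isBoundedBilinearMap_apply (𝕜 := ℝ) (E := A) (F := B)).hasFDerivAt
      (c x, a x)).hasMFDerivAt.comp x h1
  rw [mvfderiv, HasMFDerivAt.mfderiv h2]
  exact add_comm _ _

theorem mdifferentiableAt_comp_chart {A : Type*} [NormedAddCommGroup A] [NormedSpace ℝ A]
    {K : E → A} (hf : MDifferentiableAt 𝓘(ℝ, F) 𝓘(ℝ, E) f x)
    (hK : DifferentiableAt ℝ K (extChartAt 𝓘(ℝ, E) (f x) (f x))) :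
    MDifferentiableAt 𝓘(ℝ, F) 𝓘(ℝ, A) (fun y => K (extChartAt 𝓘(ℝ, E) (f x) (f y))) x := by
  have h1 : MDifferentiableAt 𝓘(ℝ, E) 𝓘(ℝ, E) (extChartAt 𝓘(ℝ, E) (f x)) (f x) :=
    mdifferentiableAt_extChartAt (by simp)
  exact hK.mdifferentiableAt.comp x (h1.comp x hf)

theorem mvfderiv_comp_chart_along {A : Type*} [NormedAddCommGroup A] [NormedSpace ℝ A]
    {K : E → A} (hf : MDifferentiableAt 𝓘(ℝ, F) 𝓘(ℝ, E) f x)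
    (hK : DifferentiableAt ℝ K (extChartAt 𝓘(ℝ, E) (f x) (f x))) (v : TangentSpace 𝓘(ℝ, F) x) :
    mvfderiv 𝓘(ℝ, F) (fun y => K (extChartAt 𝓘(ℝ, E) (f x) (f y))) x v =
      fderiv ℝ K (extChartAt 𝓘(ℝ, E) (f x) (f x)) (mfderiv 𝓘(ℝ, F) 𝓘(ℝ, E) f x v) := by
  have h1 : HasMFDerivAt 𝓘(ℝ, E) 𝓘(ℝ, E) (extChartAt 𝓘(ℝ, E) (f x)) (f x)
      (mfderiv 𝓘(ℝ, E) 𝓘(ℝ, E) (extChartAt 𝓘(ℝ, E) (f x)) (f x)) :=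
    (mdifferentiableAt_extChartAt (by simp)).hasMFDerivAt
  have h2 : HasMFDerivAt 𝓘(ℝ, F) 𝓘(ℝ, A) (fun y => K (extChartAt 𝓘(ℝ, E) (f x) (f y))) x _ :=
    hK.hasFDerivAt.hasMFDerivAt.comp x (h1.comp x hf.hasMFDerivAt)
  rw [mvfderiv, HasMFDerivAt.mfderiv h2]
  have h3 : ∀ w : E, chartD E (f x) (f x) w = w := fun w => by rw [chartD_self]; rfl
  exact congrArg (fderiv ℝ K (extChartAt 𝓘(ℝ, E) (f x) (f x)))
    (h3 (mfderiv 𝓘(ℝ, F) 𝓘(ℝ, E) f x v))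

omit [IsManifold 𝓘(ℝ, E) ∞ P] in
theorem eventually_source_along (hf : MDifferentiableAt 𝓘(ℝ, F) 𝓘(ℝ, E) f x) :
    ∀ᶠ y in 𝓝 x, f y ∈ (extChartAt 𝓘(ℝ, E) (f x)).source :=
  hf.continuousAt.eventually (source_mem_nhds' (mem_extChartAt_source (I := 𝓘(ℝ, E)) (f x)))

omit [TopologicalSpace M] in
/-- A tensor field applied to a field along `f`, in coordinates. -/
theorem chartD_end_apply
    (A : Π y : P, TangentSpace 𝓘(ℝ, E) y →L[ℝ] TangentSpace 𝓘(ℝ, E) y)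
    (s : Π y : M, TangentSpace 𝓘(ℝ, E) (f y)) {y : M}
    (hy : f y ∈ (extChartAt 𝓘(ℝ, E) (f x)).source) :
    chartD E (f x) (f y) (A (f y) (s y)) =
      endCoord A (f x) (extChartAt 𝓘(ℝ, E) (f x) (f y)) (chartD E (f x) (f y) (s y)) := by
  rw [endCoord_extChartAt A hy]
  have : frame (f x) (chartD E (f x) (f y) (s y)) (f y) = s y := chartInvD_chartD hy _
  rw [this]

theorem DiffAlongAt.end_apply
    {A : Π y : P, TangentSpace 𝓘(ℝ, E) y →L[ℝ] TangentSpace 𝓘(ℝ, E) y}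
    {s : Π y : M, TangentSpace 𝓘(ℝ, E) (f y)} (hs : DiffAlongAt (F := F) f s x)
    (hf : MDifferentiableAt 𝓘(ℝ, F) 𝓘(ℝ, E) f x)
    (hA : DifferentiableAt ℝ (endCoord A (f x)) (extChartAt 𝓘(ℝ, E) (f x) (f x))) :
    DiffAlongAt (F := F) f (fun y => A (f y) (s y)) x := by
  have h : MDifferentiableAt 𝓘(ℝ, F) 𝓘(ℝ, E) (fun y => endCoord A (f x)
      (extChartAt 𝓘(ℝ, E) (f x) (f y)) (chartD E (f x) (f y) (s y))) x :=
    (mdifferentiableAt_comp_chart hf hA).clm_apply hs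
  refine h.congr_of_eventuallyEq ?_
  filter_upwards [eventually_source_along hf] with y hy using chartD_end_apply A s hy

namespace SemiRiemannianMetric

variable (g : SemiRiemannianMetric E P)

/-- The product rule `∇̄_v (A s) = (∇_{df v} A) s + A ∇̄_v s` for a vector field `s` along `f`. -/
theorem covDeriv_end_apply
    {A : Π y : P, TangentSpace 𝓘(ℝ, E) y →L[ℝ] TangentSpace 𝓘(ℝ, E) y}
    {s : Π y : M, TangentSpace 𝓘(ℝ, E) (f y)} (hs : DiffAlongAt (F := F) f s x)
    (hf : MDifferentiableAt 𝓘(ℝ, F) 𝓘(ℝ, E) f x)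
    (hA : DifferentiableAt ℝ (endCoord A (f x)) (extChartAt 𝓘(ℝ, E) (f x) (f x)))
    (v : TangentSpace 𝓘(ℝ, F) x) :
    g.covDeriv f (fun y => A (f y) (s y)) x v =
      g.covTensor A (f x) (mfderiv 𝓘(ℝ, F) 𝓘(ℝ, E) f x v) (s x)
        + A (f x) (g.covDeriv f s x v) := by
  have h1 : (fun y => chartD E (f x) (f y) (A (f y) (s y))) =ᶠ[𝓝 x] fun y => endCoord A (f x)
      (extChartAt 𝓘(ℝ, E) (f x) (f y)) (chartD E (f x) (f y) (s y)) := by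
    filter_upwards [eventually_source_along hf] with y hy using chartD_end_apply A s hy
  have h2 : mvfderiv 𝓘(ℝ, F) (fun y => chartD E (f x) (f y) (A (f y) (s y))) x v =
      fderiv ℝ (endCoord A (f x)) (extChartAt 𝓘(ℝ, E) (f x) (f x))
        (mfderiv 𝓘(ℝ, F) 𝓘(ℝ, E) f x v) (chartD E (f x) (f x) (s x)) +
      endCoord A (f x) (extChartAt 𝓘(ℝ, E) (f x) (f x))
        (mvfderiv 𝓘(ℝ, F) (fun y => chartD E (f x) (f y) (s y)) x v) := by
    rw [mvfderiv, h1.mfderiv_eq, ← mvfderiv_comp_chart_along hf hA]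
    exact mvfderiv_clm_apply (mdifferentiableAt_comp_chart hf hA) hs v
  have h3 : ∀ (Γ d w s s' : E) (D : E →L[ℝ] E →L[ℝ] E) (K : E →L[ℝ] E), s' = s →
      Γ = g.christoffel (f x) d (K s) → D d s' + K w + Γ =
        (D d s + g.christoffel (f x) d (K s) - K (g.christoffel (f x) d s))
          + K (w + g.christoffel (f x) d s) := by
    rintro _ d w s _ D K rfl rfl
    rw [map_add]; abel
  have h4 : chartD E (f x) (f x) (s x) = s x := by rw [chartD_self]; rfl
  have h5 : ∀ w : E, endCoord A (f x) (extChartAt 𝓘(ℝ, E) (f x) (f x)) w = A (f x) w :=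
    endCoord_self A
  have h6 : (A (f x) (g.covDeriv f s x v) : E) = endCoord A (f x) (extChartAt 𝓘(ℝ, E) (f x) (f x))
      (g.covDeriv f s x v) := (h5 _).symm
  rw [h6]
  change (mvfderiv 𝓘(ℝ, F) (fun y => chartD E (f x) (f y) (A (f y) (s y))) x v : E) + _ = _
  rw [h2]
  exact h3 _ _ _ _ _ _ _ h4 (congrArg (g.christoffel (f x) _) (h5 _).symm)

set_option synthInstance.maxHeartbeats 200000 in
/-- The Levi-Civita derivative along a map is compatible with the metric. -/
theorem mvfderiv_inner_along [FiniteDimensional ℝ E]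
    {s t : Π y : M, TangentSpace 𝓘(ℝ, E) (f y)} (hs : DiffAlongAt (F := F) f s x)
    (ht : DiffAlongAt (F := F) f t x) (hf : MDifferentiableAt 𝓘(ℝ, F) 𝓘(ℝ, E) f x)
    (v : TangentSpace 𝓘(ℝ, F) x) :
    mvfderiv 𝓘(ℝ, F) (fun y => g.inner (f y) (s y) (t y)) x v =
      g.inner (f x) (g.covDeriv f s x v) (t x) + g.inner (f x) (s x) (g.covDeriv f t x v) := by
  have h1 : (fun y => g.inner (f y) (s y) (t y)) =ᶠ[𝓝 x] fun y => g.coord (f x)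
      (extChartAt 𝓘(ℝ, E) (f x) (f y)) (chartD E (f x) (f y) (s y))
        (chartD E (f x) (f y) (t y)) := by
    filter_upwards [eventually_source_along hf] with y hy
    rw [g.coord_extChartAt hy]
    have h : ∀ s : TangentSpace 𝓘(ℝ, E) (f y),
        frame (f x) (chartD E (f x) (f y) s) (f y) = s := fun s => chartInvD_chartD hy s
    rw [h, h]
  have hc := g.differentiableAt_coord (p := f x)
  have h2 : mvfderiv 𝓘(ℝ, F) (fun y => g.inner (f y) (s y) (t y)) x v =
      fderiv ℝ (g.coord (f x)) (extChartAt 𝓘(ℝ, E) (f x) (f x))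
        (mfderiv 𝓘(ℝ, F) 𝓘(ℝ, E) f x v) (chartD E (f x) (f x) (s x)) (chartD E (f x) (f x) (t x)) +
      g.coord (f x) (extChartAt 𝓘(ℝ, E) (f x) (f x))
        (mvfderiv 𝓘(ℝ, F) (fun y => chartD E (f x) (f y) (s y)) x v)
        (chartD E (f x) (f x) (t x)) +
      g.coord (f x) (extChartAt 𝓘(ℝ, E) (f x) (f x)) (chartD E (f x) (f x) (s x))
        (mvfderiv 𝓘(ℝ, F) (fun y => chartD E (f x) (f y) (t y)) x v) := by
    have h0 := mvfderiv_comp_chart_along (A := E →L[ℝ] E →L[ℝ] ℝ) hf hc v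
    have hm := mdifferentiableAt_comp_chart (A := E →L[ℝ] E →L[ℝ] ℝ) hf hc
    rw [mvfderiv, h1.mfderiv_eq]
    refine (mvfderiv_clm_apply (hm.clm_apply hs) ht v).trans ?_
    rw [mvfderiv_clm_apply hm hs v]
    exact congrArg (fun D : E →L[ℝ] E →L[ℝ] ℝ => D (chartD E (f x) (f x) (s x))
      (chartD E (f x) (f x) (t x)) + _ + _) h0
  have key : ∀ (d a b s s' t t' : E), s' = s → t' = t →
      fderiv ℝ (g.coord (f x)) (extChartAt 𝓘(ℝ, E) (f x) (f x)) d s' t' +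
        g.coord (f x) (extChartAt 𝓘(ℝ, E) (f x) (f x)) a t' +
        g.coord (f x) (extChartAt 𝓘(ℝ, E) (f x) (f x)) s' b =
      g.coord (f x) (extChartAt 𝓘(ℝ, E) (f x) (f x)) (a + g.christoffel (f x) d s) t +
        g.coord (f x) (extChartAt 𝓘(ℝ, E) (f x) (f x)) s (b + g.christoffel (f x) d t) := by
    rintro d a b s _ t _ rfl rfl
    rw [g.fderiv_coord, map_add, map_add, add_apply]
    ring
  have h4 : ∀ s : E, chartD E (f x) (f x) s = s := fun s => by rw [chartD_self]; rfl
  rw [h2]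
  exact (key _ _ _ _ _ _ _ (h4 _) (h4 _)).trans
    (congrArg₂ (· + ·) (g.coord_self _ _) (g.coord_self _ _))

end SemiRiemannianMetric

end Along

/-! ### Lifting vector fields through an immersion -/

section Lift

variable {E : Type*} [NormedAddCommGroup E] [NormedSpace ℝ E]
  {P : Type*} [TopologicalSpace P] [ChartedSpace E P] [IsManifold 𝓘(ℝ, E) ∞ P]
  {F : Type*} [NormedAddCommGroup F] [NormedSpace ℝ F]
  {M : Type*} [TopologicalSpace M] [ChartedSpace F M] {f : M → P} {x : M}

theorem diffAlongAt_of_contMDiffAt {s : Π x : M, TangentSpace 𝓘(ℝ, E) (f x)}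
    (hs : ContMDiffAt 𝓘(ℝ, F) 𝓘(ℝ, E).tangent ∞
      (fun y => (⟨f y, s y⟩ : TangentBundle 𝓘(ℝ, E) P)) x) : DiffAlongAt (F := F) f s x :=
  (contMDiffAt_chartD_apply hs).mdifferentiableAt (by simp)

theorem contMDiffAt_of_chartD_apply {s : Π x : M, TangentSpace 𝓘(ℝ, E) (f x)}
    (hf : ContMDiffAt 𝓘(ℝ, F) 𝓘(ℝ, E) ∞ f x)
    (hs : ContMDiffAt 𝓘(ℝ, F) 𝓘(ℝ, E) ∞ (fun y => chartD E (f x) (f y) (s y)) x) :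
    ContMDiffAt 𝓘(ℝ, F) 𝓘(ℝ, E).tangent ∞
      (fun y => (⟨f y, s y⟩ : TangentBundle 𝓘(ℝ, E) P)) x := by
  refine contMDiffAt_totalSpace.2 ⟨hf, hs.congr_of_eventuallyEq ?_⟩
  filter_upwards [eventually_source_along (hf.mdifferentiableAt (by simp))] with y hy
  have h1 := DFunLike.congr_fun (continuousLinearMapAt_eq_chartD (E := E) (p := f x) hy) (s y)
  refine Eq.trans ?_ h1
  rw [Trivialization.continuousLinearMapAt_apply, Trivialization.linearMapAt_apply, if_pos]
  simpa using hy

variable [IsManifold 𝓘(ℝ, F) ∞ M]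

theorem contMDiffAt_mfderiv_apply (hf : ContMDiff 𝓘(ℝ, F) 𝓘(ℝ, E) ∞ f)
    {ξ : Π y : M, TangentSpace 𝓘(ℝ, F) y}
    (hξ : ContMDiffAt 𝓘(ℝ, F) 𝓘(ℝ, F).tangent ∞
      (fun z => (⟨z, ξ z⟩ : TangentBundle 𝓘(ℝ, F) M)) x) :
    ContMDiffAt 𝓘(ℝ, F) 𝓘(ℝ, E).tangent ∞
      (fun y => (⟨f y, mfderiv 𝓘(ℝ, F) 𝓘(ℝ, E) f y (ξ y)⟩ : TangentBundle 𝓘(ℝ, E) P)) x :=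
  ContMDiffAt.comp x ((hf.contMDiff_tangentMap (m := ∞) (by simp)).contMDiffAt) hξ

/-- A vector field on `M` is smooth if its image under an immersion is smooth. -/
theorem contMDiffAt_of_mfderiv_apply [FiniteDimensional ℝ F] (hf : ContMDiff 𝓘(ℝ, F) 𝓘(ℝ, E) ∞ f)
    (hinj : Function.Injective (mfderiv 𝓘(ℝ, F) 𝓘(ℝ, E) f x)) [FiniteDimensional ℝ E]
    {ξ : Π y : M, TangentSpace 𝓘(ℝ, F) y} {s : Π x : M, TangentSpace 𝓘(ℝ, E) (f x)}
    (hs : ContMDiffAt 𝓘(ℝ, F) 𝓘(ℝ, E).tangent ∞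
      (fun y => (⟨f y, s y⟩ : TangentBundle 𝓘(ℝ, E) P)) x)
    (h : ∀ᶠ y in 𝓝 x, mfderiv 𝓘(ℝ, F) 𝓘(ℝ, E) f y (ξ y) = s y) :
    ContMDiffAt 𝓘(ℝ, F) 𝓘(ℝ, F).tangent ∞
      (fun z => (⟨z, ξ z⟩ : TangentBundle 𝓘(ℝ, F) M)) x := by
  have hcF : CompleteSpace F := FiniteDimensional.complete ℝ F
  -- the derivative of `f` in the charts at `x` and `f x`
  let D : M → F →L[ℝ] E := fun y => (chartD E (f x) (f y)).comp
    (ContinuousLinearMap.comp (mfderiv 𝓘(ℝ, F) 𝓘(ℝ, E) f y : F →L[ℝ] E)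
      (chartInvD x (extChartAt 𝓘(ℝ, F) x y)))
  have hsrc := source_mem_nhds' (mem_extChartAt_source (I := 𝓘(ℝ, F)) x)
  have hsrc' := eventually_source_along (hf.contMDiffAt.mdifferentiableAt (x := x) (by simp))
  have hD : ContMDiffAt 𝓘(ℝ, F) 𝓘(ℝ, F →L[ℝ] E) ∞ D x := by
    have h1 := ContMDiffAt.mfderiv_const (m := ∞) (hf.contMDiffAt (x := x)) (by simp)
    refine h1.congr_of_eventuallyEq ?_
    filter_upwards [hsrc, hsrc'] with y hy hy'
    have h2 := inTangentCoordinates_eq_mfderiv_comp (I := 𝓘(ℝ, F)) (I' := 𝓘(ℝ, E)) (f := id)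
      (g := f) (ϕ := fun y => mfderiv 𝓘(ℝ, F) 𝓘(ℝ, E) f y) (x₀ := x) (x := y) (by simpa using hy)
      (by simpa using hy')
    simp only [modelWithCornersSelf_coe, range_id, mfderivWithin_univ] at h2
    exact h2.symm
  have hDx : ∀ v : F, D x v = mfderiv 𝓘(ℝ, F) 𝓘(ℝ, E) f x v := by
    intro v
    have h1 : ∀ w : E, chartD E (f x) (f x) w = w := fun w => by rw [chartD_self]; rfl
    have h2 : chartInvD x (extChartAt 𝓘(ℝ, F) x x) v = v := by rw [chartInvD_self]; rfl
    exact (h1 _).trans (congrArg (mfderiv 𝓘(ℝ, F) 𝓘(ℝ, E) f x) h2)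
  -- near `x`, the derivative has a left inverse, which recovers `ξ` from its image
  have hker : LinearMap.ker (D x).toLinearMap = ⊥ :=
    LinearMap.ker_eq_bot.2 fun v w hvw => hinj (((hDx v).symm.trans hvw).trans (hDx w))
  obtain ⟨L₁, hL₁⟩ := LinearMap.exists_leftInverse_of_injective _ hker
  let L : E →L[ℝ] F := LinearMap.toContinuousLinearMap L₁
  have hLx : L.comp (D x) = ContinuousLinearMap.id ℝ F := by
    ext v; exact LinearMap.congr_fun hL₁ v
  have hLD : ContMDiffAt 𝓘(ℝ, F) 𝓘(ℝ, F →L[ℝ] F) ∞ (fun y => L.comp (D y)) x :=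
    contMDiffAt_const.clm_comp hD
  have hinv : ContDiffAt ℝ ∞ (ContinuousLinearMap.inverse : (F →L[ℝ] F) → (F →L[ℝ] F))
      (L.comp (D x)) := by
    rw [hLx]; exact contDiffAt_map_inverse (ContinuousLinearEquiv.refl ℝ F)
  have hLDinv : ContMDiffAt 𝓘(ℝ, F) 𝓘(ℝ, F →L[ℝ] F) ∞
      (fun y => ContinuousLinearMap.inverse (L.comp (D y))) x :=
    hinv.contMDiffAt.comp x hLD
  have hunit : ∀ᶠ y in 𝓝 x, L.comp (D y) ∈
      range ((↑) : (F ≃L[ℝ] F) → F →L[ℝ] F) := by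
    refine hLD.continuousAt.eventually ?_
    beta_reduce
    rw [hLx]
    exact ContinuousLinearEquiv.nhds (ContinuousLinearEquiv.refl ℝ F)
  refine contMDiffAt_of_chartD_apply (f := id) contMDiffAt_id ?_
  refine (hLDinv.clm_apply ((contMDiffAt_const (c := L)).clm_apply
    (contMDiffAt_chartD_apply hs))).congr_of_eventuallyEq ?_
  filter_upwards [hsrc, h, hunit] with y hy hξ hu
  obtain ⟨e, he⟩ := hu
  have h3 : D y (chartD F x y (ξ y)) = chartD E (f x) (f y) (s y) := by
    have h4 : chartInvD x (extChartAt 𝓘(ℝ, F) x y) (chartD F x y (ξ y)) = ξ y :=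
      chartInvD_chartD hy _
    exact congrArg (chartD E (f x) (f y))
      ((congrArg (mfderiv 𝓘(ℝ, F) 𝓘(ℝ, E) f y) h4).trans hξ)
  have h5 : e (chartD F x y (ξ y)) = L (chartD E (f x) (f y) (s y)) := by
    rw [← h3]; exact DFunLike.congr_fun he _
  have h6 : ContinuousLinearMap.inverse (L.comp (D y)) (L (chartD E (f x) (f y) (s y))) =
      chartD F x y (ξ y) := by
    rw [← he, ContinuousLinearMap.inverse_equiv, ← h5]
    exact e.symm_apply_apply _
  exact h6.symm

variable [FiniteDimensional ℝ F] [FiniteDimensional ℝ E] {g : SemiRiemannianMetric E P} {r : ℕ}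

/-- Every vector of the radical extends to a smooth local section of the radical. -/
theorem NullSubmanifold.exists_radical_field (N : NullSubmanifold F g f r)
    {w : TangentSpace 𝓘(ℝ, E) (f x)} (hw : w ∈ radical (F := F) g f x) :
    ∃ ξ : Π y : M, TangentSpace 𝓘(ℝ, F) y, SmoothNear ξ x ∧
      mfderiv 𝓘(ℝ, F) 𝓘(ℝ, E) f x (ξ x) = w ∧
      ∀ᶠ y in 𝓝 x, mfderiv 𝓘(ℝ, F) 𝓘(ℝ, E) f y (ξ y) ∈ radical (F := F) g f y := by
  classical
  obtain ⟨s, hs⟩ := N.radical_smooth x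
  have hw' := hw
  rw [← hs.self_of_nhds.2.2, Submodule.mem_span_range_iff_exists_fun] at hw'
  obtain ⟨c, hc⟩ := hw'
  let t : Π y : M, TangentSpace 𝓘(ℝ, E) (f y) := fun y => ∑ j, c j • s j y
  have ht : ∀ᶠ y in 𝓝 x, t y ∈ radical (F := F) g f y := by
    filter_upwards [hs] with y hy
    rw [← hy.2.2]
    exact Submodule.sum_mem _ fun j _ => Submodule.smul_mem _ _ (Submodule.subset_span ⟨j, rfl⟩)
  let ξ : Π y : M, TangentSpace 𝓘(ℝ, F) y := fun y =>
    if h : ∃ v, mfderiv 𝓘(ℝ, F) 𝓘(ℝ, E) f y v = t y then h.choose else 0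
  have hξ : ∀ᶠ y in 𝓝 x, mfderiv 𝓘(ℝ, F) 𝓘(ℝ, E) f y (ξ y) = t y := by
    filter_upwards [ht] with y hy
    have h : ∃ v, mfderiv 𝓘(ℝ, F) 𝓘(ℝ, E) f y v = t y := hy.1
    simp only [ξ, dif_pos h]
    exact h.choose_spec
  refine ⟨ξ, ?_, hξ.self_of_nhds.trans hc, ?_⟩
  · filter_upwards [hξ.eventually_nhds, hs] with y hy hsy
    refine contMDiffAt_of_mfderiv_apply N.smooth (N.immersion y) (s := t) ?_ hy
    refine contMDiffAt_of_chartD_apply (N.smooth y) ?_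
    have h1 : (fun z => chartD E (f y) (f z) (t z)) =
        fun z => ∑ j, c j • chartD E (f y) (f z) (s j z) := by
      funext z
      refine (map_sum (chartD E (f y) (f z)) (fun j => (c j • s j z : E)) _).trans ?_
      exact Finset.sum_congr rfl fun j _ => map_smul (chartD E (f y) (f z)) (c j) (s j z : E)
    rw [h1]
    exact contMDiffAt_finsetSum fun j _ =>
      (contDiff_const_smul (𝕜 := ℝ) (F := E) (c j)).contMDiff.contMDiffAt.comp y
        (contMDiffAt_chartD_apply (hsy.1 j))
  · filter_upwards [ht, hξ] with y hy hy'
    rw [hy']; exact hy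

end Lift

/-! ### The failure of metric compatibility of the induced connection -/

namespace NullSubmanifold

variable {E : Type*} [NormedAddCommGroup E] [NormedSpace ℝ E]
  {P : Type*} [TopologicalSpace P] [ChartedSpace E P] [IsManifold 𝓘(ℝ, E) ∞ P]
  {F : Type*} [NormedAddCommGroup F] [NormedSpace ℝ F]
  {M : Type*} [TopologicalSpace M] [ChartedSpace F M] {f : M → P} {x : M}
  {g : SemiRiemannianMetric E P} {r : ℕ} (N : NullSubmanifold F g f r)

theorem inner_radical_tangent {a b : TangentSpace 𝓘(ℝ, E) (f x)} (ha : a ∈ radical (F := F) g f x)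
    (hb : b ∈ tangentSub (F := F) f x) : g.inner (f x) a b = 0 := by
  rw [g.symm]
  exact ha.2 b hb

theorem inner_tangent_screenTr {a b : TangentSpace 𝓘(ℝ, E) (f x)}
    (ha : a ∈ tangentSub (F := F) f x) (hb : b ∈ N.screenTr x) : g.inner (f x) a b = 0 := by
  have h : b ∈ normalSub (F := F) g f x := by
    rw [← N.screenTr_sup x]; exact Submodule.mem_sup_right hb
  exact h a ha

theorem screen_le (x : M) : N.screen x ≤ tangentSub (F := F) f x := by
  rw [← N.screen_sup x]; exact le_sup_right

theorem inner_screen_nullTr {a b : TangentSpace 𝓘(ℝ, E) (f x)}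
    (ha : a ∈ N.screen x) (hb : b ∈ N.nullTr x) : g.inner (f x) a b = 0 := by
  have h : b ∈ (g.bilin (f x)).orthogonal (N.screen x) ⊓
      (g.bilin (f x)).orthogonal (N.screenTr x) := by
    rw [← N.nullTr_sup x]; exact Submodule.mem_sup_right hb
  exact h.1 a ha

theorem inner_screenTr_nullTr {a b : TangentSpace 𝓘(ℝ, E) (f x)}
    (ha : a ∈ N.screenTr x) (hb : b ∈ N.nullTr x) : g.inner (f x) a b = 0 := by
  have h : b ∈ (g.bilin (f x)).orthogonal (N.screen x) ⊓
      (g.bilin (f x)).orthogonal (N.screenTr x) := by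
    rw [← N.nullTr_sup x]; exact Submodule.mem_sup_right hb
  exact h.2 a ha

/-- Every tangent vector is the sum of a radical and a screen vector. -/
theorem exists_radical_add_screen (v : TangentSpace 𝓘(ℝ, F) x) :
    ∃ η ∈ radical (F := F) g f x, ∃ s ∈ N.screen x,
      mfderiv 𝓘(ℝ, F) 𝓘(ℝ, E) f x v = η + s := by
  have h : mfderiv 𝓘(ℝ, F) 𝓘(ℝ, E) f x v ∈ radical (F := F) g f x ⊔ N.screen x := by
    rw [N.screen_sup x]; exact ⟨v, rfl⟩
  obtain ⟨η, hη, s, hs, h⟩ := Submodule.mem_sup.1 h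
  exact ⟨η, hη, s, hs, h.symm⟩

variable [FiniteDimensional ℝ E]

/-- Against the screen transversal bundle, `∇̄_X Y` and `h^s(X, Y)` have the same products. -/
theorem inner_hs {w : TangentSpace 𝓘(ℝ, E) (f x)} (hw : w ∈ N.screenTr x)
    (X Y : Π y : M, TangentSpace 𝓘(ℝ, F) y) :
    g.inner (f x) w (N.hs X Y x) = g.inner (f x) w (N.ambientDeriv X Y x) := by
  have hcompl := (N.decomposition x).2
  have h1 : N.ambientDeriv X Y x - N.hs X Y x ∈ tangentSub (F := F) f x ⊔ N.nullTr x := by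
    rw [← Submodule.projection_apply_eq_zero_iff hcompl, map_sub, sub_eq_zero]
    exact (Submodule.projection_apply_of_mem_left hcompl
      (Submodule.projection_apply_mem hcompl _)).symm
  obtain ⟨t, ht, l, hl, h⟩ := Submodule.mem_sup.1 h1
  have h2 : g.inner (f x) w (N.ambientDeriv X Y x - N.hs X Y x) = 0 := by
    rw [← h, map_add, N.inner_screenTr_nullTr hw hl, g.symm, N.inner_tangent_screenTr ht hw,
      add_zero]
  rw [map_sub, sub_eq_zero] at h2
  exact h2.symm

/-- The transversal part of `∇̄_X Y` sees only the radical part of a tangent vector. -/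
theorem inner_inducedConnection (X Y : Π y : M, TangentSpace 𝓘(ℝ, F) y)
    {η s : TangentSpace 𝓘(ℝ, E) (f x)} (hη : η ∈ radical (F := F) g f x) (hs : s ∈ N.screen x) :
    g.inner (f x) (mfderiv 𝓘(ℝ, F) 𝓘(ℝ, E) f x (N.inducedConnection X Y x)) (η + s) =
      g.inner (f x) (N.ambientDeriv X Y x) (η + s) - g.inner (f x) (N.ambientDeriv X Y x) η := by
  have h1 : N.ambientDeriv X Y x - mfderiv 𝓘(ℝ, F) 𝓘(ℝ, E) f x (N.inducedConnection X Y x) ∈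
      N.nullTr x ⊔ N.screenTr x := by
    rw [← LinearMap.ker_linearProjOfIsCompl _ _ (N.immersion x) (N.decomposition x).1,
      LinearMap.mem_ker, map_sub, sub_eq_zero]
    exact (LinearMap.linearProjOfIsCompl_apply_left _ _ (N.immersion x) (N.decomposition x).1
      (N.inducedConnection X Y x)).symm
  obtain ⟨l, hl, w, hw, h⟩ := Submodule.mem_sup.1 h1
  have h2 : g.inner (f x) s (N.ambientDeriv X Y x -
      mfderiv 𝓘(ℝ, F) 𝓘(ℝ, E) f x (N.inducedConnection X Y x)) = 0 := by
    rw [← h, map_add, N.inner_screen_nullTr hs hl, N.inner_tangent_screenTr (N.screen_le x hs) hw,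
      add_zero]
  have h3 : g.inner (f x) η
      (mfderiv 𝓘(ℝ, F) 𝓘(ℝ, E) f x (N.inducedConnection X Y x)) = 0 :=
    inner_radical_tangent hη ⟨_, rfl⟩
  rw [map_sub] at h2
  rw [g.symm, g.symm _ _ (η + s), g.symm _ _ η, map_add, add_apply, add_apply, h3]
  linarith

variable [IsManifold 𝓘(ℝ, F) ∞ M]

/-- `(∇_X g)(Y, Z) = g(∇̄_X Y, η_Z) + g(∇̄_X Z, η_Y)`, where `η_Y`, `η_Z` are the radical parts of
`Y`, `Z`. -/
theorem nabla_metric (X : Π y : M, TangentSpace 𝓘(ℝ, F) y) {Y Z : Π y : M, TangentSpace 𝓘(ℝ, F) y}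
    (hY : SmoothNear Y x) (hZ : SmoothNear Z x) {η s η' s' : TangentSpace 𝓘(ℝ, E) (f x)}
    (hη : η ∈ radical (F := F) g f x) (hs : s ∈ N.screen x)
    (hYx : mfderiv 𝓘(ℝ, F) 𝓘(ℝ, E) f x (Y x) = η + s)
    (hη' : η' ∈ radical (F := F) g f x) (hs' : s' ∈ N.screen x)
    (hZx : mfderiv 𝓘(ℝ, F) 𝓘(ℝ, E) f x (Z x) = η' + s') :
    mvfderiv 𝓘(ℝ, F) (fun y => N.inducedMetric y (Y y) (Z y)) x (X x)
      - N.inducedMetric x (N.inducedConnection X Y x) (Z x)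
      - N.inducedMetric x (Y x) (N.inducedConnection X Z x) =
    g.inner (f x) (N.ambientDeriv X Y x) η' + g.inner (f x) (N.ambientDeriv X Z x) η := by
  have h1 := g.mvfderiv_inner_along
    (diffAlongAt_of_contMDiffAt (contMDiffAt_mfderiv_apply N.smooth hY.self_of_nhds))
    (diffAlongAt_of_contMDiffAt (contMDiffAt_mfderiv_apply N.smooth hZ.self_of_nhds))
    (N.smooth.contMDiffAt.mdifferentiableAt (by simp)) (X x)
  have h2 := N.inner_inducedConnection X Y hη' hs'
  have h3 := N.inner_inducedConnection X Z hη hs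
  rw [← hZx] at h2
  rw [← hYx] at h3
  have h4 : N.inducedMetric x (Y x) (N.inducedConnection X Z x) =
    g.inner (f x) (mfderiv 𝓘(ℝ, F) 𝓘(ℝ, E) f x (N.inducedConnection X Z x))
      (mfderiv 𝓘(ℝ, F) 𝓘(ℝ, E) f x (Y x)) := g.symm _ _ _
  have h5 := g.symm (f x) (mfderiv 𝓘(ℝ, F) 𝓘(ℝ, E) f x (Y x)) (N.ambientDeriv X Z x)
  have h6 : mvfderiv 𝓘(ℝ, F) (fun y => N.inducedMetric y (Y y) (Z y)) x (X x) =
      g.inner (f x) (N.ambientDeriv X Y x) (mfderiv 𝓘(ℝ, F) 𝓘(ℝ, E) f x (Z x)) +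
      g.inner (f x) (mfderiv 𝓘(ℝ, F) 𝓘(ℝ, E) f x (Y x)) (N.ambientDeriv X Z x) := h1
  have h7 : N.inducedMetric x (N.inducedConnection X Y x) (Z x) =
    g.inner (f x) (mfderiv 𝓘(ℝ, F) 𝓘(ℝ, E) f x (N.inducedConnection X Y x))
      (mfderiv 𝓘(ℝ, F) 𝓘(ℝ, E) f x (Z x)) := rfl
  rw [h4, h6, h7, h2, h3, h5]
  ring

end NullSubmanifold

/-! ### Screen real null submanifolds -/

namespace NullSubmanifold

variable {E : Type*} [NormedAddCommGroup E] [NormedSpace ℂ E]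
  {P : Type*} [TopologicalSpace P] [ChartedSpace E P] [IsManifold 𝓘(ℂ, E) ∞ P]
  {F : Type*} [NormedAddCommGroup F] [NormedSpace ℝ F]
  {M : Type*} [TopologicalSpace M] [ChartedSpace F M]
  {ι : Type*} {n r : ℕ} {C : ComplexContactMetricStructure E P ι n} {f : M → P} {x : M} {i : ι}
  (N : NullSubmanifold F C.g f r)

theorem horizontal_of_tangent (hN : N.IsScreenReal) (hx : f x ∈ C.O i)
    {a : TangentSpace 𝓘(ℝ, E) (f x)} (ha : a ∈ tangentSub (F := F) f x) :
    C.u i (f x) a = 0 ∧ C.v i (f x) a = 0 := by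
  obtain ⟨hU, hV, -⟩ := hN i x hx
  rw [← C.inner_U hx, ← C.inner_V hx]
  exact ⟨N.inner_tangent_screenTr ha hU, N.inner_tangent_screenTr ha hV⟩

theorem tensorJ_mem_radical (hN : N.IsScreenReal) (hx : f x ∈ C.O i) (m : Fin 3)
    {a : TangentSpace 𝓘(ℝ, E) (f x)} (ha : a ∈ radical (F := F) C.g f x) :
    C.tensorJ i m (f x) a ∈ radical (F := F) C.g f x := by
  rw [← ((hN i x hx).2.2 m).1]
  exact Submodule.mem_map_of_mem ha

variable [FiniteDimensional ℝ E] [IsManifold 𝓘(ℝ, F) ∞ M]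

/-- For a section `ξ` of the radical, `g(s, ∇̄_X(J_m ξ)) = -g(J_m s, h^s(X, ξ))` for `s ∈ S(TM)`:
normality makes the term with `∇̄ J_m` vanish. -/
theorem inner_screen_covDeriv (hC : C.IsNormal) (hN : N.IsScreenReal) (hx : f x ∈ C.O i)
    (m : Fin 3) (X : Π y : M, TangentSpace 𝓘(ℝ, F) y) {ξ : Π y : M, TangentSpace 𝓘(ℝ, F) y}
    (hξ : SmoothNear ξ x)
    (hξR : mfderiv 𝓘(ℝ, F) 𝓘(ℝ, E) f x (ξ x) ∈ radical (F := F) C.g f x)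
    {s : TangentSpace 𝓘(ℝ, E) (f x)} (hs : s ∈ N.screen x) :
    C.g.inner (f x) s (C.g.covDeriv f
      (fun y => C.tensorJ i m (f y) (mfderiv 𝓘(ℝ, F) 𝓘(ℝ, E) f y (ξ y))) x (X x)) =
    -C.g.inner (f x) (C.tensorJ i m (f x) s) (N.hs X ξ x) := by
  have hsT := N.screen_le x hs
  rw [C.g.covDeriv_end_apply
    (diffAlongAt_of_contMDiffAt (contMDiffAt_mfderiv_apply N.smooth hξ.self_of_nhds))
    (N.smooth.contMDiffAt.mdifferentiableAt (by simp)) (C.differentiableAt_endCoord_tensorJ hx m)]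
  obtain ⟨k, τ, hτ⟩ := C.exists_inner_covTensor hC hx m
  have hX := N.horizontal_of_tangent hN hx (a := mfderiv 𝓘(ℝ, F) 𝓘(ℝ, E) f x (X x)) ⟨_, rfl⟩
  have hξ' := N.horizontal_of_tangent hN hx hξR.1
  have hs' := N.horizontal_of_tangent hN hx hsT
  have h1 := hτ _ _ _ hX.1 hX.2 hξ'.1 hξ'.2 hs'.1 hs'.2
  rw [inner_radical_tangent (N.tensorJ_mem_radical hN hx k hξR) hsT, mul_zero, C.g.symm] at h1
  have h2 : C.tensorJ i m (f x) s ∈ N.screenTr x :=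
    ((hN i x hx).2.2 m).2 (Submodule.mem_map_of_mem hs)
  rw [map_add, h1, zero_add, N.inner_hs h2, C.tensorJ_skew hx, neg_neg]
  rfl

/-- If `ζ = J_m ξ` for a section `ξ` of the radical, then `g(∇̄_X Y, ζ) = -g(Y, ∇̄_X ζ)`, because
the radical is orthogonal to `TM`. -/
theorem inner_ambientDeriv_radical (hN : N.IsScreenReal) (hx : f x ∈ C.O i)
    (m : Fin 3) (X : Π y : M, TangentSpace 𝓘(ℝ, F) y) {Y ξ : Π y : M, TangentSpace 𝓘(ℝ, F) y}
    (hY : SmoothNear Y x) (hξ : SmoothNear ξ x)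
    (hξR : ∀ᶠ y in 𝓝 x, mfderiv 𝓘(ℝ, F) 𝓘(ℝ, E) f y (ξ y) ∈ radical (F := F) C.g f y) :
    C.g.inner (f x) (N.ambientDeriv X Y x)
        (C.tensorJ i m (f x) (mfderiv 𝓘(ℝ, F) 𝓘(ℝ, E) f x (ξ x))) =
      -C.g.inner (f x) (mfderiv 𝓘(ℝ, F) 𝓘(ℝ, E) f x (Y x)) (C.g.covDeriv f
        (fun y => C.tensorJ i m (f y) (mfderiv 𝓘(ℝ, F) 𝓘(ℝ, E) f y (ξ y))) x (X x)) := by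
  have hf : MDifferentiableAt 𝓘(ℝ, F) 𝓘(ℝ, E) f x :=
    N.smooth.contMDiffAt.mdifferentiableAt (by simp)
  have h1 := C.g.mvfderiv_inner_along
    (diffAlongAt_of_contMDiffAt (contMDiffAt_mfderiv_apply N.smooth hY.self_of_nhds))
    ((diffAlongAt_of_contMDiffAt (contMDiffAt_mfderiv_apply N.smooth
      hξ.self_of_nhds)).end_apply hf (C.differentiableAt_endCoord_tensorJ hx m)) hf (X x)
  have h2 : (fun y => C.g.inner (f y) (mfderiv 𝓘(ℝ, F) 𝓘(ℝ, E) f y (Y y))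
      (C.tensorJ i m (f y) (mfderiv 𝓘(ℝ, F) 𝓘(ℝ, E) f y (ξ y)))) =ᶠ[𝓝 x] fun _ => 0 := by
    filter_upwards [hξR, hf.continuousAt.preimage_mem_nhds ((C.isOpen i).mem_nhds hx)] with y hy hyO
    rw [C.g.symm]
    exact inner_radical_tangent (N.tensorJ_mem_radical hN hyO m hy) ⟨_, rfl⟩
  have h3 : mvfderiv 𝓘(ℝ, F) (fun y => C.g.inner (f y) (mfderiv 𝓘(ℝ, F) 𝓘(ℝ, E) f y (Y y))
      (C.tensorJ i m (f y) (mfderiv 𝓘(ℝ, F) 𝓘(ℝ, E) f y (ξ y)))) x (X x) = 0 := by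
    rw [mvfderiv, h2.mfderiv_eq, mfderiv_const]
    rfl
  rw [h3] at h1
  exact eq_neg_of_add_eq_zero_left h1.symm

variable [FiniteDimensional ℝ F]

/-- For `s ∈ S(TM)` and a section `ξ` of the radical, `(∇_X g)(s, J_m ξ)` is
`g(J_m s, h^s(X, ξ))`. -/
theorem noScreenComponent_of_isMetricConnection (hC : C.IsNormal) (hN : N.IsScreenReal)
    (h : N.IsMetricConnection) (m : Fin 3) : N.NoScreenComponent m := by
  intro i x hx X ξ hX hξ hξR
  rintro _ ⟨s, hs, rfl⟩
  change C.g.inner (f x) (C.tensorJ i m (f x) s) (N.hs X ξ x) = 0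
  have hcF : CompleteSpace F := FiniteDimensional.complete ℝ F
  obtain ⟨v, hv⟩ := N.screen_le x hs
  obtain ⟨w, hw⟩ := (N.tensorJ_mem_radical hN hx m hξR.self_of_nhds).1
  -- `Y` extends `s`, and `Z` extends `J_m ξ`
  have hY := smoothNear_frame (mem_extChartAt_source (I := 𝓘(ℝ, F)) x) v
  have hZ := smoothNear_frame (mem_extChartAt_source (I := 𝓘(ℝ, F)) x) w
  have hYx : mfderiv 𝓘(ℝ, F) 𝓘(ℝ, E) f x (frame (E := F) x v x) = 0 + s := by
    rw [zero_add]; exact (congrArg _ (frame_self (E := F) x v)).trans hv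
  have hZx : mfderiv 𝓘(ℝ, F) 𝓘(ℝ, E) f x (frame (E := F) x w x) =
      C.tensorJ i m (f x) (mfderiv 𝓘(ℝ, F) 𝓘(ℝ, E) f x (ξ x)) + 0 := by
    rw [add_zero]; exact (congrArg _ (frame_self (E := F) x w)).trans hw
  have h1 := N.nabla_metric X hY hZ (zero_mem _) hs hYx
    (N.tensorJ_mem_radical hN hx m hξR.self_of_nhds) (zero_mem _) hZx
  rw [h x X _ _ hX hY hZ, map_zero, add_zero] at h1
  have h2 := N.inner_ambientDeriv_radical hN hx m X hY hξ hξR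
  rw [hYx, zero_add, ← h1, N.inner_screen_covDeriv hC hN hx m X hξ hξR.self_of_nhds hs] at h2
  linarith

/-- If no `h^s(X, ξ)` has a component in `J_m S(TM)`, then `(∇_X g)(Y, Z)` involves the radical
parts of `Y` and `Z` only, and these contribute `-X(g(η_Y, η_Z)) = 0`. -/
theorem isMetricConnection_of_noScreenComponent (hC : C.IsNormal) (hN : N.IsScreenReal) {m : Fin 3}
    (h : N.NoScreenComponent m) : N.IsMetricConnection := by
  intro x X Y Z hX hY hZ
  obtain ⟨i, hx⟩ := C.cover (f x)
  obtain ⟨η, hη, s, hs, hYx⟩ := N.exists_radical_add_screen (Y x)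
  obtain ⟨η', hη', s', hs', hZx⟩ := N.exists_radical_add_screen (Z x)
  rw [N.nabla_metric X hY hZ hη hs hYx hη' hs' hZx]
  -- extend the radical parts of `Y` and `Z` to sections `J_m ξ`, `J_m ξ'` of the radical
  have hlift : ∀ η ∈ radical (F := F) C.g f x, ∃ ξ : Π y : M, TangentSpace 𝓘(ℝ, F) y,
      SmoothNear ξ x ∧ C.tensorJ i m (f x) (mfderiv 𝓘(ℝ, F) 𝓘(ℝ, E) f x (ξ x)) = η ∧
      ∀ᶠ y in 𝓝 x, mfderiv 𝓘(ℝ, F) 𝓘(ℝ, E) f y (ξ y) ∈ radical (F := F) C.g f y := by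
    intro η hη
    rw [← ((hN i x hx).2.2 m).1] at hη
    obtain ⟨ρ, hρ, rfl⟩ := hη
    obtain ⟨ξ, hξ, hξx, hξR⟩ := N.exists_radical_field hρ
    exact ⟨ξ, hξ, by rw [hξx]; rfl, hξR⟩
  obtain ⟨ξ, hξ, hξx, hξR⟩ := hlift η hη
  obtain ⟨ξ', hξ', hξx', hξR'⟩ := hlift η' hη'
  have hscreen : ∀ ξ : Π y : M, TangentSpace 𝓘(ℝ, F) y, SmoothNear ξ x →
      (∀ᶠ y in 𝓝 x, mfderiv 𝓘(ℝ, F) 𝓘(ℝ, E) f y (ξ y) ∈ radical (F := F) C.g f y) →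
      ∀ s ∈ N.screen x, C.g.inner (f x) s (C.g.covDeriv f
        (fun y => C.tensorJ i m (f y) (mfderiv 𝓘(ℝ, F) 𝓘(ℝ, E) f y (ξ y))) x (X x)) = 0 := by
    intro ξ hξ hξR s hs
    rw [N.inner_screen_covDeriv hC hN hx m X hξ hξR.self_of_nhds hs, neg_eq_zero]
    exact h i x hx X ξ hX hξ hξR _ (Submodule.mem_map_of_mem hs)
  have h1 := N.inner_ambientDeriv_radical hN hx m X hY hξ' hξR'
  have h2 := N.inner_ambientDeriv_radical hN hx m X hZ hξ hξR
  have hsplit : ∀ η s D : TangentSpace 𝓘(ℝ, E) (f x), C.g.inner (f x) s D = 0 →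
      C.g.inner (f x) (η + s) D = C.g.inner (f x) η D := by
    intro η s D hD
    rw [C.g.symm, map_add, C.g.symm _ D s, hD, add_zero, C.g.symm]
  rw [hξx', hYx, hsplit _ _ _ (hscreen ξ' hξ' hξR' s hs)] at h1
  rw [hξx, hZx, hsplit _ _ _ (hscreen ξ hξ hξR s' hs')] at h2
  -- the extensions of the radical parts are orthogonal to each other
  have hf : MDifferentiableAt 𝓘(ℝ, F) 𝓘(ℝ, E) f x :=
    N.smooth.contMDiffAt.mdifferentiableAt (by simp)
  have hdiff : ∀ ξ : Π y : M, TangentSpace 𝓘(ℝ, F) y, SmoothNear ξ x → DiffAlongAt (F := F) f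
      (fun y => C.tensorJ i m (f y) (mfderiv 𝓘(ℝ, F) 𝓘(ℝ, E) f y (ξ y))) x := fun ξ hξ =>
    (diffAlongAt_of_contMDiffAt (contMDiffAt_mfderiv_apply N.smooth
      hξ.self_of_nhds)).end_apply hf (C.differentiableAt_endCoord_tensorJ hx m)
  have h3 := C.g.mvfderiv_inner_along (hdiff ξ hξ) (hdiff ξ' hξ') hf (X x)
  have h4 : (fun y => C.g.inner (f y)
      (C.tensorJ i m (f y) (mfderiv 𝓘(ℝ, F) 𝓘(ℝ, E) f y (ξ y)))
      (C.tensorJ i m (f y) (mfderiv 𝓘(ℝ, F) 𝓘(ℝ, E) f y (ξ' y)))) =ᶠ[𝓝 x] fun _ => 0 := by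
    filter_upwards [hξR, hξR', hf.continuousAt.preimage_mem_nhds ((C.isOpen i).mem_nhds hx)]
      with y hy hy' hyO
    exact inner_radical_tangent (N.tensorJ_mem_radical hN hyO m hy)
      (N.tensorJ_mem_radical hN hyO m hy').1
  rw [mvfderiv, h4.mfderiv_eq, mfderiv_const, hξx, hξx'] at h3
  rw [h1, h2, C.g.symm _ η']
  have h5 : (0 : ℝ) = _ := h3
  linarith

end NullSubmanifold

end NullGeometry

theorem mainTheorem3
    {E : Type*} [NormedAddCommGroup E] [NormedSpace ℂ E] [FiniteDimensional ℂ E]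
    {P : Type*} [TopologicalSpace P] [ChartedSpace E P] [IsManifold 𝓘(ℂ, E) ∞ P]
    {F : Type*} [NormedAddCommGroup F] [NormedSpace ℝ F] [FiniteDimensional ℝ F]
    {M : Type*} [TopologicalSpace M] [ChartedSpace F M] [IsManifold 𝓘(ℝ, F) ∞ M]
    {ι : Type*} {n q r : ℕ} (hq : 0 < q) (hqn : q < n)
    (C : NullGeometry.ComplexContactMetricStructure E P ι n)
    (hindex : C.g.HasIndex (4 * q)) (hnormal : C.IsNormal)
    (f : M → P) (N : NullGeometry.NullSubmanifold F C.g f r) (hN : N.IsScreenReal) :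
    (N.IsMetricConnection ↔ ∀ a : Fin 3, N.NoScreenComponent a) ∧
      ∀ a : Fin 3, (N.IsMetricConnection ↔ N.NoScreenComponent a) :=
  ⟨⟨fun h a => N.noScreenComponent_of_isMetricConnection hnormal hN h a,
      fun h => N.isMetricConnection_of_noScreenComponent hnormal hN (h 0)⟩,
    fun a => ⟨fun h => N.noScreenComponent_of_isMetricConnection hnormal hN h a,
      fun h => N.isMetricConnection_of_noScreenComponent hnormal hN h⟩⟩
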